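/- Let $\Gamma$ be a cancellation monoid (not necessarily commutative, with left and right cancellation), and let $R=\bigoplus_{\alpha\in\Gamma}R_\alpha$ be a $\Gamma$-graded associative ring with identity (not necessarily commutative): each $R_\alpha$ is an additive subgroup and $R_\alpha R_\beta\subseteq R_{\alpha\beta}$. A left (resp. right) ideal is called homogeneous if it is generated by homogeneous elements. The ring $R$ is graded left (resp. right) semihereditary if every finitely generated homogeneous left (resp. right) ideal of $R$ is a projective $R$-module, and graded left (resp. right) coherent if every finitely generated homogeneous left (resp. right) ideal of $R$ is a finitely presented $R$-module. A $\Gamma$-graded left $R$-module is a left $R$-module $M=\bigoplus_{\alpha\in\Gamma}M_\alpha$ with each $M_\alpha$ an additive subgroup and $R_\alpha M_\beta\subseteq M_{\alpha\beta}$; a $\Gamma$-graded right $R$-module is defined likewise with $M_\beta R_\alpha\subseteq M_{\beta\alpha}$. The flat dimension $\operatorname{fd}_R(M)\in\mathbb N\cup\{\infty\}$ is the least $n$ for which there is an exact sequence $0\to F_n\to\cdots\to F_0\to M\to 0$ with all $F_i$ flat, and $\infty$ if there is none. Put $$\text{gr-}\ell\mathrm{wD}(R)=\sup\{\operatorname{fd}_R(M)\mid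 M\text{ a }\Gamma\text{-graded left }R\text{-module}\},$$ $$\text{gr-rwD}(R)=\sup\{\operatorname{fd}_R(M)\mid M\text{ a }\Gamma\text{-graded right }R\text{-module}\}.$$ Then $\text{gr-}\ell\mathrm{wD}(R)=\text{gr-rwD}(R)$; this common value is called the graded weak dimension $\text{gr-wD}(R)$. Moreover, $R$ is graded left semihereditary if and only if $R$ is graded left coherent and $\text{gr-wD}(R)\le 1$, and $R$ is graded right semihereditary if and only if $R$ is graded right coherent and $\text{gr-wD}(R)\le 1$. -/

import Mathlib

open scoped TensorProduct

namespace GrSemihereditary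

universe u v w x

section Tensor

/-- The subgroup of `N ⊗[ℤ] M` generated by the elements `(n r) ⊗ m - n ⊗ (r m)`. Right `R`-modules
are modules over `Rᵐᵒᵖ`, with `n r = MulOpposite.op r • n`. -/
def balancedRelations (R : Type u) [Ring R]
    (N : Type v) [AddCommGroup N] [Module Rᵐᵒᵖ N]
    (M : Type w) [AddCommGroup M] [Module R M] : AddSubgroup (N ⊗[ℤ] M) :=
  AddSubgroup.closure
    {t | ∃ (n : N) (r : R) (m : M), t = (MulOpposite.op r • n) ⊗ₜ[ℤ] m - n ⊗ₜ[ℤ] (r • m)}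

/-- The tensor product `N ⊗_R M` (an abelian group) of a right module `N` and a left module `M` over
a not necessarily commutative ring `R`. -/
abbrev BalancedTensor (R : Type u) [Ring R]
    (N : Type v) [AddCommGroup N] [Module Rᵐᵒᵖ N]
    (M : Type w) [AddCommGroup M] [Module R M] : Type (max v w) :=
  (N ⊗[ℤ] M) ⧸ balancedRelations R N M

/-- The homomorphism `f ⊗ g : N ⊗_R M → N' ⊗_R M'`. -/
def BalancedTensor.map (R : Type u) [Ring R]
    {N N' : Type v} [AddCommGroup N] [Module Rᵐᵒᵖ N] [AddCommGroup N'] [Module Rᵐᵒᵖ N']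
    {M M' : Type w} [AddCommGroup M] [Module R M] [AddCommGroup M'] [Module R M']
    (f : N →ₗ[Rᵐᵒᵖ] N') (g : M →ₗ[R] M') :
    BalancedTensor R N M →+ BalancedTensor R N' M' :=
  QuotientAddGroup.map (balancedRelations R N M) (balancedRelations R N' M')
    (TensorProduct.map f.toAddMonoidHom.toIntLinearMap
      g.toAddMonoidHom.toIntLinearMap).toAddMonoidHom
    (by
      refine (AddSubgroup.closure_le _).2 ?_
      rintro _ ⟨n, r, m, rfl⟩
      rw [SetLike.mem_coe, AddSubgroup.mem_comap, map_sub]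
      exact AddSubgroup.subset_closure ⟨f n, r, g m, by simp⟩)

/-- A left `R`-module `M` is flat if `- ⊗_R M` preserves injectivity of homomorphisms of right
`R`-modules. -/
def IsFlatLeft (R : Type u) [Ring R] (M : Type u) [AddCommGroup M] [Module R M] : Prop :=
  ∀ (N N' : Type u) [AddCommGroup N] [AddCommGroup N'] [Module Rᵐᵒᵖ N] [Module Rᵐᵒᵖ N']
    (f : N →ₗ[Rᵐᵒᵖ] N'), Function.Injective f →
      Function.Injective (BalancedTensor.map R f (LinearMap.id : M →ₗ[R] M))

/-- A right `R`-module `N` is flat if `N ⊗_R -` preserves injectivity of homomorphisms of left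
`R`-modules. -/
def IsFlatRight (R : Type u) [Ring R] (N : Type u) [AddCommGroup N] [Module Rᵐᵒᵖ N] : Prop :=
  ∀ (M M' : Type u) [AddCommGroup M] [AddCommGroup M'] [Module R M] [Module R M']
    (g : M →ₗ[R] M'), Function.Injective g →
      Function.Injective (BalancedTensor.map R (LinearMap.id : N →ₗ[Rᵐᵒᵖ] N) g)

end Tensor

section FlatDimension

/-- `M` has a resolution `0 → F n → ⋯ → F 1 → F 0 → M → 0` by `S`-modules in the class `P`
(written as an infinite exact sequence with `F i = 0` for `i > n`). -/
def HasResolutionOfLength (S : Type u) [Ring S] (P : ModuleCat.{u} S → Prop)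
    (M : Type u) [AddCommGroup M] [Module S M] (n : ℕ) : Prop :=
  ∃ (F : ℕ → ModuleCat.{u} S) (d : ∀ i, F (i + 1) →ₗ[S] F i) (ε : F 0 →ₗ[S] M),
    (∀ i, P (F i)) ∧ Function.Surjective ε ∧ Function.Exact (d 0) ε ∧
      (∀ i, Function.Exact (d (i + 1)) (d i)) ∧ ∀ i, n < i → Subsingleton (F i)

/-- The flat dimension of a left `R`-module: the least length of a finite flat resolution, and `⊤`
if there is none. -/
noncomputable def flatDimLeft (R : Type u) [Ring R] (M : Type u) [AddCommGroup M] [Module R M] :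
    ℕ∞ :=
  ⨅ (n : ℕ) (_ : HasResolutionOfLength R (fun F => IsFlatLeft R F) M n), (n : ℕ∞)

/-- The flat dimension of a right `R`-module. -/
noncomputable def flatDimRight (R : Type u) [Ring R] (N : Type u) [AddCommGroup N]
    [Module Rᵐᵒᵖ N] : ℕ∞ :=
  ⨅ (n : ℕ) (_ : HasResolutionOfLength Rᵐᵒᵖ (fun F => IsFlatRight R F) N n), (n : ℕ∞)

end FlatDimension

section Graded

variable {Γ : Type x} [AddCancelMonoid Γ] [DecidableEq Γ] {R : Type u} [Ring R]

/-- `𝓜` makes the left `R`-module `M` a `Γ`-graded left module: `M` is the internal direct sum of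
the `𝓜 β`, and `R_α M_β ⊆ M_{α + β}`. -/
structure IsGradedLeftModule (𝒜 : Γ → AddSubgroup R) {M : Type v} [AddCommGroup M] [Module R M]
    (𝓜 : Γ → AddSubgroup M) : Prop where
  isInternal : DirectSum.IsInternal 𝓜
  smul_mem : ∀ (α β : Γ) (r : R) (m : M), r ∈ 𝒜 α → m ∈ 𝓜 β → r • m ∈ 𝓜 (α + β)

/-- `𝓝` makes the right `R`-module `N` a `Γ`-graded right module: `N` is the internal direct sum of
the `𝓝 β`, and `N_β R_α ⊆ N_{β + α}`. -/
structure IsGradedRightModule (𝒜 : Γ → AddSubgroup R) {N : Type v} [AddCommGroup N]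
    [Module Rᵐᵒᵖ N] (𝓝 : Γ → AddSubgroup N) : Prop where
  isInternal : DirectSum.IsInternal 𝓝
  smul_mem : ∀ (α β : Γ) (r : R) (n : N), r ∈ 𝒜 α → n ∈ 𝓝 β →
    MulOpposite.op r • n ∈ 𝓝 (β + α)

/-- A homogeneous left ideal: a left ideal generated by homogeneous elements. -/
def IsHomogeneousLeftIdeal (𝒜 : Γ → AddSubgroup R) (I : Submodule R R) : Prop :=
  ∃ s : Set R, (∀ a ∈ s, SetLike.IsHomogeneousElem 𝒜 a) ∧ Submodule.span R s = I

/-- A homogeneous right ideal: a right ideal generated by homogeneous elements. -/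
def IsHomogeneousRightIdeal (𝒜 : Γ → AddSubgroup R) (I : Submodule Rᵐᵒᵖ R) : Prop :=
  ∃ s : Set R, (∀ a ∈ s, SetLike.IsHomogeneousElem 𝒜 a) ∧ Submodule.span Rᵐᵒᵖ s = I

/-- Every finitely generated homogeneous left ideal is a projective left module. -/
def IsGradedLeftSemihereditary (𝒜 : Γ → AddSubgroup R) : Prop :=
  ∀ I : Submodule R R, IsHomogeneousLeftIdeal 𝒜 I → I.FG → Module.Projective R I

/-- Every finitely generated homogeneous right ideal is a projective right module. -/
def IsGradedRightSemihereditary (𝒜 : Γ → AddSubgroup R) : Prop :=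
  ∀ I : Submodule Rᵐᵒᵖ R, IsHomogeneousRightIdeal 𝒜 I → I.FG → Module.Projective Rᵐᵒᵖ I

/-- Every finitely generated homogeneous left ideal is a finitely presented left module. -/
def IsGradedLeftCoherent (𝒜 : Γ → AddSubgroup R) : Prop :=
  ∀ I : Submodule R R, IsHomogeneousLeftIdeal 𝒜 I → I.FG → Module.FinitePresentation R I

/-- Every finitely generated homogeneous right ideal is a finitely presented right module. -/
def IsGradedRightCoherent (𝒜 : Γ → AddSubgroup R) : Prop :=
  ∀ I : Submodule Rᵐᵒᵖ R, IsHomogeneousRightIdeal 𝒜 I → I.FG → Module.FinitePresentation Rᵐᵒᵖ I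

/-- The graded left weak dimension: the supremum of the flat dimensions of the `Γ`-graded left
`R`-modules. -/
noncomputable def grLeftWeakDim (𝒜 : Γ → AddSubgroup R) : ℕ∞ :=
  ⨆ (M : Type u) (_ : AddCommGroup M) (_ : Module R M) (𝓜 : Γ → AddSubgroup M)
    (_ : IsGradedLeftModule 𝒜 𝓜), flatDimLeft R M

/-- The graded right weak dimension: the supremum of the flat dimensions of the `Γ`-graded right
`R`-modules. -/
noncomputable def grRightWeakDim (𝒜 : Γ → AddSubgroup R) : ℕ∞ :=
  ⨆ (N : Type u) (_ : AddCommGroup N) (_ : Module Rᵐᵒᵖ N) (𝓝 : Γ → AddSubgroup N)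
    (_ : IsGradedRightModule 𝒜 𝓝), flatDimRight R N

/-- The graded weak dimension, the common value of the left and the right one. It is defined as the
left one; that the two agree is part of the theorem in which it is used. -/
noncomputable def grWeakDim (𝒜 : Γ → AddSubgroup R) : ℕ∞ :=
  grLeftWeakDim 𝒜

end Graded

end GrSemihereditary

/-! Everything reduces to the vanishing of Tor, handled through characters. As `ℚ / ℤ` is an
injective cogenerator, `f ⊗ g` is injective exactly when every balanced pairing into `ℚ / ℤ` extends
along `f × g` (`BalancedTensor.map_injective_iff`). An exchange argument for pairings
(`Extends.exchange`) makes the resulting `Tor₁` symmetric and independent of the flat covers, and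
dimension shifting gives the higher ones (`torVanishes_ker_iff`).

The graded input is that a graded module `M` is flat as soon as `J ⊗ M → M` is injective for the
finitely generated homogeneous ideals `J` of the other side (`IsGradedModule.flat`), and projective
if it is moreover finitely presented with finitely many homogeneous generators
(`IsGradedModule.projective`). Passing to kernels of graded free covers, `fd M ≤ n` follows from the
vanishing of `Tor_{n+1}` of `M` against the cyclic modules `T / J`
(`IsGradedModule.hasFlatResolution`). These are themselves graded modules of the other side, so any
bound on one weak dimension bounds the other.

If the finitely generated homogeneous ideals `J` of one side are projective, they are finitely
presented, and `Tor₂(M, T / J) = Tor₁(M, J) = 0` bounds the weak dimension by one. Conversely, weak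
dimension at most one gives `Tor₁(T / J, I) = Tor₂(T / J, S / I) = 0` for a homogeneous ideal `I`;
if `I` is also finitely presented, it is projective.

The two sides are treated at once: `S` and `T` are rings with an additive bijection `σ` reversing
products, specialised to `R` and `Rᵐᵒᵖ` in either order. -/

namespace GrSemihereditary

universe u v w x

/-! ### Characters of abelian groups -/

/-- The divisible cogenerator `ℚ / ℤ` of the category of abelian groups. -/
abbrev QModZ : Type := AddCircle (1 : ℚ)

/-- The hypothesis lets `q` factor through `P / ker p`, which embeds in `M`; then `ℚ / ℤ` is
injective. -/
theorem exists_character_extending {P : Type v} {M : Type w} [AddCommGroup P] [AddCommGroup M]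
    (p : P →+ M) (q : P →+ QModZ) (h : ∀ x, p x = 0 → q x = 0) :
    ∃ ψ : M →+ QModZ, ∀ x, ψ (p x) = q x := by
  obtain ⟨ψ, hψ⟩ := CharacterModule.dual_surjective_of_injective (R := ℤ)
    (QuotientAddGroup.kerLift p).toIntLinearMap (QuotientAddGroup.kerLift_injective p)
    (QuotientAddGroup.lift p.ker q fun x hx => h x hx)
  exact ⟨ψ, fun x => DFunLike.congr_fun hψ (x : P ⧸ p.ker)⟩

theorem exists_character_separating {E : Type v} [AddCommGroup E] (Q : AddSubgroup E) {x : E}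
    (hx : x ∉ Q) : ∃ χ : E →+ QModZ, (∀ y ∈ Q, χ y = 0) ∧ χ x ≠ 0 := by
  obtain ⟨c, hc⟩ := CharacterModule.exists_character_apply_ne_zero_of_ne_zero
    (a := (x : E ⧸ Q)) (by rwa [Ne, QuotientAddGroup.eq_zero_iff])
  refine ⟨AddMonoidHom.comp c (QuotientAddGroup.mk' Q), fun y hy => ?_, hc⟩
  have : (y : E ⧸ Q) = 0 := (QuotientAddGroup.eq_zero_iff y).2 hy
  change c (y : E ⧸ Q) = 0
  rw [this]
  exact map_zero (show (E ⧸ Q) →+ QModZ from c)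

theorem exists_descent_of_surjective {F : Type v} {N : Type w} {A : Type x} [AddCommGroup F]
    [AddCommGroup N] [AddCommGroup A] (f : F →+ N) (hf : Function.Surjective f) (b : F →+ A)
    (h : ∀ x, f x = 0 → b x = 0) : ∃ c : N →+ A, ∀ x, c (f x) = b x :=
  ⟨f.liftOfSurjective hf ⟨b, fun x hx => h x hx⟩,
    fun x => f.liftOfRightInverse_comp_apply _ _ ⟨b, fun x hx => h x hx⟩ x⟩

/-! ### Balanced maps -/

section Balanced

variable {S T : Type u} [Ring S] [Ring T] (σ : S ≃+ T)
variable {N N' : Type v} [AddCommGroup N] [Module T N] [AddCommGroup N'] [Module T N']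
variable {M M' : Type w} [AddCommGroup M] [Module S M] [AddCommGroup M'] [Module S M']

/-- A biadditive map `N × M → ℚ / ℤ` is balanced if `b (n s, m) = b (n, s m)`, where the right
action of `S` on `N` is the action of `T` along the anti-isomorphism `σ`. -/
def IsBalanced (b : N →+ M →+ QModZ) : Prop :=
  ∀ (s : S) (n : N) (m : M), b (σ s • n) m = b n (s • m)

/-- Balanced maps on `N × M` extend along `f × g`; equivalently, `f ⊗ g` is injective. -/
def Extends (f : N →ₗ[T] N') (g : M →ₗ[S] M') : Prop :=
  ∀ b : N →+ M →+ QModZ, IsBalanced σ b →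
    ∃ b' : N' →+ M' →+ QModZ, IsBalanced σ b' ∧ ∀ n m, b' (f n) (g m) = b n m

/-- Flatness of the `S`-module `M`, with right `S`-modules regarded as `T`-modules along `σ`. -/
def Flat (M : Type u) [AddCommGroup M] [Module S M] : Prop :=
  ∀ (N N' : Type u) [AddCommGroup N] [AddCommGroup N'] [Module T N] [Module T N']
    (f : N →ₗ[T] N'), Function.Injective f → Extends σ f (LinearMap.id : M →ₗ[S] M)

variable {σ}

theorem IsBalanced.flip {b : N →+ M →+ QModZ} (hb : IsBalanced σ b) :
    IsBalanced σ.symm b.flip := fun t m n => by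
  simpa using (hb (σ.symm t) n m).symm

theorem Extends.flip {f : N →ₗ[T] N'} {g : M →ₗ[S] M'} (h : Extends σ f g) :
    Extends σ.symm g f := fun b hb => by
  obtain ⟨b', h1, h2⟩ := h b.flip hb.flip
  exact ⟨b'.flip, h1.flip, fun n m => h2 m n⟩

theorem extends_symm_iff {f : N →ₗ[T] N'} {g : M →ₗ[S] M'} :
    Extends σ.symm g f ↔ Extends σ f g := ⟨fun h => h.flip, fun h => h.flip⟩

theorem Extends.comp {N'' : Type v} [AddCommGroup N''] [Module T N'']
    {M'' : Type w} [AddCommGroup M''] [Module S M'']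
    {f : N →ₗ[T] N'} {g : M →ₗ[S] M'} {f' : N' →ₗ[T] N''} {g' : M' →ₗ[S] M''}
    (h' : Extends σ f' g') (h : Extends σ f g) : Extends σ (f' ∘ₗ f) (g' ∘ₗ g) := fun b hb => by
  obtain ⟨b', h1, h2⟩ := h b hb
  obtain ⟨b'', h3, h4⟩ := h' b' h1
  exact ⟨b'', h3, fun n m => (h4 _ _).trans (h2 n m)⟩

theorem IsBalanced.comp {b : N' →+ M' →+ QModZ} (hb : IsBalanced σ b) (f : N →ₗ[T] N')
    (g : M →ₗ[S] M') :
    IsBalanced σ ((AddMonoidHom.compHom' g.toAddMonoidHom).comp (b.comp f.toAddMonoidHom)) :=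
  fun s n m => by simpa using hb s (f n) (g m)

/-- If `f' ∘ f` and `g' ∘ g` admit extensions then so do `f` and `g`. -/
theorem Extends.of_comp {N'' : Type v} [AddCommGroup N''] [Module T N'']
    {M'' : Type w} [AddCommGroup M''] [Module S M'']
    {f : N →ₗ[T] N'} {g : M →ₗ[S] M'} {f' : N' →ₗ[T] N''} {g' : M' →ₗ[S] M''}
    (h : Extends σ (f' ∘ₗ f) (g' ∘ₗ g)) : Extends σ f g := fun b hb => by
  obtain ⟨b', h1, h2⟩ := h b hb
  exact ⟨_, h1.comp f' g', h2⟩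

theorem IsBalanced.sub {b c : N →+ M →+ QModZ} (hb : IsBalanced σ b) (hc : IsBalanced σ c) :
    IsBalanced σ (b - c) := fun s n m => by
  simp [hb s n m, hc s n m]

theorem IsBalanced.exists_descent {b : N →+ M →+ QModZ} (hb : IsBalanced σ b) (f : N →ₗ[T] N')
    (hf : Function.Surjective f) (h : ∀ n, f n = 0 → ∀ m, b n m = 0) :
    ∃ c : N' →+ M →+ QModZ, IsBalanced σ c ∧ ∀ n m, c (f n) m = b n m := by
  obtain ⟨c, hc⟩ := exists_descent_of_surjective f.toAddMonoidHom hf b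
    fun n hn => AddMonoidHom.ext fun m => h n hn m
  have hc' : ∀ n m, c (f n) m = b n m := fun n m => DFunLike.congr_fun (hc n) m
  refine ⟨c, fun s n m => ?_, hc'⟩
  obtain ⟨n, rfl⟩ := hf n
  rw [← map_smul, hc', hc', hb]

/-- Symmetry of `Tor₁`: if `N ⊗ ker g → N ⊗ G` is injective and `G` is flat over `ker f ⊆ F`, then
`ker f ⊗ M → F ⊗ M` is injective. -/
theorem Extends.exchange {f : N →ₗ[T] N'} (hf : Function.Surjective f) {g : M →ₗ[S] M'}
    (hg : Function.Surjective g)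
    (hG : Extends σ (LinearMap.ker f).subtype (LinearMap.id : M →ₗ[S] M))
    (h : Extends σ (LinearMap.id : N' →ₗ[T] N') (LinearMap.ker g).subtype) :
    Extends σ (LinearMap.ker f).subtype (LinearMap.id : M' →ₗ[S] M') := fun b hb => by
  obtain ⟨d, hd, hdb⟩ := hG _ (hb.comp LinearMap.id g)
  replace hdb : ∀ (n : LinearMap.ker f) m, d n m = b n (g m) := hdb
  -- On `ker f × ker g` the pairing `d` is zero, because there it equals `b n (g m)`. So its
  -- restriction to `N × ker g` descends along `f`.
  obtain ⟨c, hc, hcd⟩ := (hd.comp LinearMap.id (LinearMap.ker g).subtype).exists_descent f hf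
    fun n hn m => by
      have := hdb ⟨n, hn⟩ m
      rw [LinearMap.mem_ker.1 m.2, map_zero] at this
      exact this
  replace hcd : ∀ n (m : LinearMap.ker g), c (f n) m = d n m := hcd
  obtain ⟨c', hc', hcc⟩ := h c hc
  replace hcc : ∀ n (m : LinearMap.ker g), c' n m = c n m := hcc
  -- Subtracting the extension `c'` of `c` kills `N × ker g`, so the difference descends along `g`.
  -- The correction is invisible on `ker f`, where `c' (f n)` is zero.
  obtain ⟨e, he, hed⟩ := (hd.sub (hc'.comp f LinearMap.id)).flip.exists_descent g hg
    fun m hm n => by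
      have := (hcc (f n) ⟨m, hm⟩).trans (hcd n ⟨m, hm⟩)
      exact sub_eq_zero.2 this.symm
  refine ⟨e.flip, he.flip, fun n m => ?_⟩
  obtain ⟨m, rfl⟩ := hg m
  have h1 : d n m - c' (f n) m = b n (g m) := by
    rw [LinearMap.mem_ker.1 n.2, map_zero, hdb]
    exact sub_zero _
  exact (hed m n).trans h1

theorem Flat.extends_ker {M : Type u} [AddCommGroup M] [Module S M] (hM : Flat σ M)
    {N N' : Type u} [AddCommGroup N] [AddCommGroup N'] [Module T N] [Module T N']
    (f : N →ₗ[T] N') : Extends σ (LinearMap.ker f).subtype (LinearMap.id : M →ₗ[S] M) :=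
  hM _ _ _ (Submodule.injective_subtype _)

end Balanced

/-! ### Character modules over the opposite side -/

section Dual

variable {S T : Type u} [Ring S] [Ring T] {σ : S ≃+ T}

theorem symm_mul_rev (hσ : ∀ a b, σ (a * b) = σ b * σ a) (a b : T) :
    σ.symm (a * b) = σ.symm b * σ.symm a := by
  rw [σ.symm_apply_eq, hσ, σ.apply_symm_apply, σ.apply_symm_apply]

theorem map_one_of_rev (hσ : ∀ a b, σ (a * b) = σ b * σ a) : σ 1 = 1 := by
  have h := hσ 1 (σ.symm 1)
  rwa [one_mul, σ.apply_symm_apply, one_mul, eq_comm] at h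

/-- The `T`-module structure on the character group of an `S`-module. -/
abbrev dualModule (hσ : ∀ a b, σ (a * b) = σ b * σ a) (M : Type w) [AddCommGroup M] [Module S M] :
    Module T (M →+ QModZ) where
  smul t c := c.comp (DistribSMul.toAddMonoidHom M (σ.symm t))
  one_smul c := AddMonoidHom.ext fun m => by
    change c (σ.symm 1 • m) = c m
    rw [map_one_of_rev (symm_mul_rev hσ), one_smul]
  mul_smul a b c := AddMonoidHom.ext fun m => by
    change c (σ.symm (a * b) • m) = c (σ.symm b • σ.symm a • m)
    rw [symm_mul_rev hσ, mul_smul]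
  smul_zero _ := rfl
  smul_add _ _ _ := rfl
  add_smul a b c := AddMonoidHom.ext fun m => by
    change c (σ.symm (a + b) • m) = c (σ.symm a • m) + c (σ.symm b • m)
    rw [map_add, add_smul, map_add]
  zero_smul c := AddMonoidHom.ext fun m => by
    change c (σ.symm 0 • m) = 0
    rw [map_zero, zero_smul, map_zero]

/-- Flatness from lifting of relations along a linear map from any module: the criterion is tested
on ideals by means of Baer's theorem for the character module. -/
theorem flat_of_lifts (hσ : ∀ a b, σ (a * b) = σ b * σ a) {M : Type u} [AddCommGroup M]
    [Module S M] {ι : Type u} (π : (ι →₀ S) →ₗ[S] M)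
    (h : ∀ (κ : Type u) (s : Finset κ) (r : κ → S) (m : κ → M), ∑ i ∈ s, r i • m i = 0 →
      ∃ g : κ → ι →₀ S, (∀ i ∈ s, π (g i) = m i) ∧ ∑ i ∈ s, r i • g i = 0) : Flat σ M := by
  classical
  intro N N' _ _ _ _ f hf b hb
  let _ := dualModule hσ M
  have hB : Module.Baer T (M →+ QModZ) := by
    intro J c
    have hc : ∀ (t : T) (x : J) m, c (t • x) m = c x (σ.symm t • m) := fun t x m =>
      DFunLike.congr_fun (map_smul c t x) m
    -- The sought `ψ` must satisfy `ψ (σ.symm x • m) = c x m`. Such a `ψ` exists if every relation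
    -- `∑ σ.symm x • z x = 0` forces `∑ c x (z x) = 0`.
    let p : (J →₀ M) →+ M :=
      Finsupp.liftAddHom fun x => DistribSMul.toAddMonoidHom M (σ.symm x)
    let q : (J →₀ M) →+ QModZ := Finsupp.liftAddHom fun x => c x
    obtain ⟨ψ, hψ⟩ := exists_character_extending p q fun z hz => by
      have hz' : ∑ x ∈ z.support, σ.symm (x : T) • z x = 0 := hz
      obtain ⟨g, hg, hg0⟩ := h J z.support (fun x => σ.symm x) z hz'
      change ∑ x ∈ z.support, c x (z x) = 0
      let D : Finset ι := z.support.biUnion fun x => (g x).support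
      have hD : ∀ x ∈ z.support, z x = ∑ j ∈ D, g x j • π (Finsupp.single j 1) := by
        intro x hx
        rw [← hg x hx]
        conv_lhs => rw [← Finsupp.sum_single (g x)]
        rw [Finsupp.sum, map_sum]
        refine Finset.sum_subset_zero_on_sdiff
          (Finset.subset_biUnion_of_mem (fun x => (g x).support) hx) (fun j hj => ?_)
          fun j _ => ?_
        · rw [Finsupp.notMem_support_iff.1 (Finset.mem_sdiff.1 hj).2, zero_smul]
        · rw [← map_smul, Finsupp.smul_single, smul_eq_mul, mul_one]
      have h1 : ∀ x ∈ z.support, c x (z x) =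
          ∑ j ∈ D, c (σ (g x j) • x) (π (Finsupp.single j 1)) := fun x hx => by
        conv_lhs => rw [hD x hx, map_sum]
        exact Finset.sum_congr rfl fun j _ => by rw [hc, σ.symm_apply_apply]
      -- After exchanging the sums, the first argument of `c` at `j` is the `j`-th coordinate of the
      -- lifted relation, transported by `σ`; hence it vanishes.
      rw [Finset.sum_congr rfl h1, Finset.sum_comm]
      refine Finset.sum_eq_zero fun j _ => ?_
      rw [← AddMonoidHom.finsetSum_apply, ← map_sum]
      have h2 : ∑ x ∈ z.support, σ (g x j) • x = 0 := by
        apply Subtype.ext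
        have h3 := congrArg (fun y => σ (y j)) hg0
        simp only [Finsupp.coe_finsetSum, Finset.sum_apply, Finsupp.smul_apply, map_sum,
          smul_eq_mul, hσ, σ.apply_symm_apply, Finsupp.coe_zero, Pi.zero_apply, map_zero] at h3
        simpa using h3
      rw [h2, map_zero, AddMonoidHom.zero_apply]
    refine ⟨LinearMap.toSpanSingleton T _ ψ, fun x hx => AddMonoidHom.ext fun m => ?_⟩
    have := hψ (Finsupp.single ⟨x, hx⟩ m)
    simp only [p, q, Finsupp.liftAddHom_apply_single] at this
    exact this
  let bl : N →ₗ[T] (M →+ QModZ) :=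
    { b with
      map_smul' := fun t n => AddMonoidHom.ext fun m => by
        have := hb (σ.symm t) n m
        rw [σ.apply_symm_apply] at this
        exact this }
  obtain ⟨b', hb'⟩ := Module.Baer.extension_property hB f hf bl
  refine ⟨b'.toAddMonoidHom, fun s n m => ?_, fun n m => ?_⟩
  · have := DFunLike.congr_fun (map_smul b' (σ s) n) m
    change b' (σ s • n) m = _
    rw [this]
    change b' n (σ.symm (σ s) • m) = _
    rw [σ.symm_apply_apply]
    rfl
  · exact DFunLike.congr_fun (LinearMap.congr_fun hb' n) m

theorem flat_finsupp (hσ : ∀ a b, σ (a * b) = σ b * σ a) (ι : Type u) : Flat σ (ι →₀ S) :=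
  flat_of_lifts hσ LinearMap.id fun _ _ _ m hm => ⟨m, fun _ _ => rfl, hm⟩

/-- A linear section of the canonical free cover lifts every relation. -/
theorem flat_of_projective (hσ : ∀ a b, σ (a * b) = σ b * σ a) (P : Type u) [AddCommGroup P]
    [Module S P] [Module.Projective S P] : Flat σ P := by
  obtain ⟨s, hs⟩ := Module.projective_def'.1 (inferInstance : Module.Projective S P)
  refine flat_of_lifts hσ (Finsupp.linearCombination S id) fun _ t r m hm =>
    ⟨fun i => s (m i), fun i _ => LinearMap.congr_fun hs (m i), ?_⟩
  simp only [← map_smul]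
  rw [← map_sum, hm, map_zero]

/-- If `J ⊗ M → M` is injective for the one-sided ideal `J` generated by the coefficients of a
relation in `M`, then the relation lifts along every surjection onto `M`. -/
theorem exists_lift_of_extends (hσ : ∀ a b, σ (a * b) = σ b * σ a) {M : Type u}
    [AddCommGroup M] [Module S M] {G : Type w} [AddCommGroup G] [Module S G] (π : G →ₗ[S] M)
    (hπ : Function.Surjective π) {κ : Type*} [Fintype κ] (r : κ → S)
    (hJ : Extends σ (Submodule.span T (Set.range fun i => σ (r i))).subtype
      (LinearMap.id : M →ₗ[S] M))
    (m : κ → M) (hm : ∑ i, r i • m i = 0) :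
    ∃ g : κ → G, (∀ i, π (g i) = m i) ∧ ∑ i, r i • g i = 0 := by
  classical
  -- `Q` consists of the families that lift to a relation in `G`. If `m` were not among them, a
  -- character `χ` would vanish on `Q` but not at `m`.
  let Q : AddSubgroup (κ → M) :=
    { carrier := {y | ∃ g : κ → G, (∀ i, π (g i) = y i) ∧ ∑ i, r i • g i = 0}
      zero_mem' := ⟨0, by simp, by simp⟩
      add_mem' := by
        rintro _ _ ⟨g, hg, hg0⟩ ⟨g', hg', hg0'⟩
        exact ⟨g + g', fun i => by simp [hg, hg'],
          by simp [smul_add, Finset.sum_add_distrib, hg0, hg0']⟩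
      neg_mem' := by
        rintro _ ⟨g, hg, hg0⟩
        exact ⟨-g, fun i => by simp [hg], by simp [hg0]⟩ }
  by_contra hcon
  obtain ⟨χ, hχ, hne⟩ := exists_character_separating Q (x := m) hcon
  let _ := dualModule hσ M
  let ρ : (κ → T) →ₗ[T] T := Fintype.linearCombination T fun i => σ (r i)
  have hρ : LinearMap.range ρ = Submodule.span T (Set.range fun i => σ (r i)) :=
    Fintype.range_linearCombination T _
  -- `β` factors through the image of `ρ`, which is the ideal `J`: if `ρ a = 0`, the family `σ.symm
  -- (a i) • y` lifts, using any preimage of `y`, to a relation, so `χ` kills it. The induced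
  -- pairing on `J × M` extends to `T × M`, and evaluating at `1` forces `χ m = 0`.
  let β : (κ → T) →ₗ[T] (M →+ QModZ) :=
    { toFun := fun a => χ.comp (AddMonoidHom.pi fun i => DistribSMul.toAddMonoidHom M (σ.symm (a i)))
      map_add' := fun a a' => AddMonoidHom.ext fun y => by
        change χ (fun i => σ.symm (a i + a' i) • y) =
          χ (fun i => σ.symm (a i) • y) + χ (fun i => σ.symm (a' i) • y)
        rw [← map_add]
        congr 1
        funext i
        simp [add_smul]
      map_smul' := fun t a => AddMonoidHom.ext fun y => by
        change χ (fun i => σ.symm (t * a i) • y) = χ (fun i => σ.symm (a i) • σ.symm t • y)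
        congr 1
        funext i
        rw [symm_mul_rev hσ, mul_smul] }
  have hβ : LinearMap.ker ρ ≤ LinearMap.ker β := fun a ha => by
    refine LinearMap.mem_ker.2 (AddMonoidHom.ext fun y => hχ _ ?_)
    obtain ⟨z, rfl⟩ := hπ y
    refine ⟨fun i => σ.symm (a i) • z, fun i => map_smul π _ z, ?_⟩
    have h1 : ∑ i, a i * σ (r i) = 0 := ha
    have h2 := congrArg σ.symm h1
    rw [map_sum, map_zero] at h2
    simp only [symm_mul_rev hσ, σ.symm_apply_apply] at h2
    simp only [smul_smul]
    rw [← Finset.sum_smul, h2, zero_smul]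
  rw [← hρ] at hJ
  let c : LinearMap.range ρ →ₗ[T] (M →+ QModZ) :=
    (Submodule.liftQ _ β hβ) ∘ₗ ρ.quotKerEquivRange.symm.toLinearMap
  have hcβ : ∀ a, c ⟨ρ a, LinearMap.mem_range_self ρ a⟩ = β a := fun a => by
    have : ρ.quotKerEquivRange.symm ⟨ρ a, LinearMap.mem_range_self ρ a⟩ =
        (LinearMap.ker ρ).mkQ a := ρ.quotKerEquivRange_symm_apply_image a _
    change Submodule.liftQ _ β hβ (ρ.quotKerEquivRange.symm _) = β a
    rw [this]
    exact Submodule.liftQ_apply _ _ _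
  obtain ⟨b', hb', hbc⟩ := hJ c.toAddMonoidHom fun s n y => by
    have := DFunLike.congr_fun (map_smul c (σ s) n) y
    change c (σ s • n) y = c n (s • y)
    rw [this]
    change c n (σ.symm (σ s) • y) = _
    rw [σ.symm_apply_apply]
  replace hbc : ∀ (n : LinearMap.range ρ) y, b' n y = c n y := hbc
  apply hne
  have h1 : χ m = ∑ i, b' 1 (r i • m i) := by
    conv_lhs => rw [← Finset.univ_sum_single m]
    rw [map_sum]
    refine Finset.sum_congr rfl fun i _ => ?_
    rw [← hb']
    have h2 : ρ (Pi.single i 1) = σ (r i) • (1 : T) := by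
      simp [ρ, Fintype.linearCombination_apply, Pi.single_apply]
    have h3 := hbc ⟨ρ (Pi.single i 1), LinearMap.mem_range_self ρ _⟩ (m i)
    rw [hcβ] at h3
    rw [← h2]
    refine Eq.trans ?_ h3.symm
    change _ = χ (fun j => σ.symm ((Pi.single i 1 : κ → T) j) • m i)
    congr 1
    funext j
    by_cases hj : j = i
    · subst hj
      simp [map_one_of_rev (symm_mul_rev hσ)]
    · simp [hj]
  rw [h1, ← map_sum, hm, map_zero]

end Dual

/-! ### Comparison with the tensor product -/

section Tensor

variable {R : Type u} [Ring R]

/-- The canonical anti-isomorphism of a ring onto its opposite, as an additive equivalence. -/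
abbrev opAdd (R : Type u) [Ring R] : R ≃+ Rᵐᵒᵖ := MulOpposite.opAddEquiv

theorem opAdd_mul (a b : R) : opAdd R (a * b) = opAdd R b * opAdd R a := rfl

variable {N N' : Type v} [AddCommGroup N] [Module Rᵐᵒᵖ N] [AddCommGroup N'] [Module Rᵐᵒᵖ N']
variable {M M' : Type w} [AddCommGroup M] [Module R M] [AddCommGroup M'] [Module R M']

theorem BalancedTensor.exists_lift {b : N →+ M →+ QModZ} (hb : IsBalanced (opAdd R) b) :
    ∃ c : BalancedTensor R N M →+ QModZ,
      ∀ n m, c (QuotientAddGroup.mk (n ⊗ₜ[ℤ] m)) = b n m := by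
  let l : N ⊗[ℤ] M →+ QModZ := TensorProduct.liftAddHom b fun k n m => by simp
  refine ⟨QuotientAddGroup.lift (balancedRelations R N M) l ?_, fun n m => ?_⟩
  · refine (AddSubgroup.closure_le l.ker).2 ?_
    rintro _ ⟨n, r, m, rfl⟩
    rw [SetLike.mem_coe, AddMonoidHom.mem_ker, map_sub, sub_eq_zero]
    exact hb r n m
  · rfl

theorem BalancedTensor.exists_isBalanced (c : BalancedTensor R N M →+ QModZ) :
    ∃ b : N →+ M →+ QModZ, IsBalanced (opAdd R) b ∧
      ∀ n m, b n m = c (QuotientAddGroup.mk (n ⊗ₜ[ℤ] m)) := by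
  let k : N ⊗[ℤ] M →+ QModZ := c.comp (QuotientAddGroup.mk' (balancedRelations R N M))
  refine ⟨AddMonoidHom.mk' (fun n => AddMonoidHom.mk' (fun m => k (n ⊗ₜ[ℤ] m)) fun m m' => ?_)
    fun n n' => AddMonoidHom.ext fun m => ?_, fun r n m => ?_, fun n m => rfl⟩
  · rw [TensorProduct.tmul_add, map_add]
  · exact (congrArg k (TensorProduct.add_tmul n n' m)).trans (map_add k _ _)
  · refine congrArg c ((QuotientAddGroup.eq_iff_sub_mem).2 ?_)
    exact AddSubgroup.subset_closure ⟨n, r, m, rfl⟩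

/-- Balanced pairings are the characters of the tensor product, and a homomorphism of abelian groups
is injective exactly when every character extends along it. -/
theorem BalancedTensor.map_injective_iff (f : N →ₗ[Rᵐᵒᵖ] N') (g : M →ₗ[R] M') :
    Function.Injective (BalancedTensor.map R f g) ↔ Extends (opAdd R) f g := by
  constructor
  · intro h b hb
    obtain ⟨c, hc⟩ := BalancedTensor.exists_lift hb
    obtain ⟨c', hc'⟩ := exists_character_extending (BalancedTensor.map R f g) c fun z hz => by
      rw [h (hz.trans (map_zero _).symm), map_zero]
    obtain ⟨b', hb', hbc⟩ := BalancedTensor.exists_isBalanced c'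
    refine ⟨b', hb', fun n m => ?_⟩
    rw [hbc, ← hc, ← hc']
    rfl
  · intro h
    rw [injective_iff_map_eq_zero]
    intro z hz
    by_contra hne
    obtain ⟨c, -, hc⟩ := exists_character_separating (⊥ : AddSubgroup (BalancedTensor R N M))
      (x := z) (by simpa using hne)
    obtain ⟨b, hb, hbc⟩ := BalancedTensor.exists_isBalanced c
    obtain ⟨b', hb', hbb⟩ := h b hb
    obtain ⟨c', hc'⟩ := BalancedTensor.exists_lift hb'
    have key : ∀ y, c' (BalancedTensor.map R f g y) = c y := by
      intro y
      obtain ⟨y, rfl⟩ := QuotientAddGroup.mk_surjective y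
      induction y using TensorProduct.induction_on with
      | zero => exact (congrArg c' (map_zero _)).trans ((map_zero _).trans (map_zero c).symm)
      | tmul n m => rw [← hbc, ← hbb, ← hc']; rfl
      | add y y' hy hy' =>
        rw [QuotientAddGroup.mk_add, map_add, map_add, map_add, hy, hy']
    exact hc (by rw [← key, hz, map_zero])

theorem isFlatLeft_iff (M : Type u) [AddCommGroup M] [Module R M] :
    IsFlatLeft R M ↔ Flat (opAdd R) M :=
  forall_congr' fun _ => forall_congr' fun _ => forall_congr' fun _ => forall_congr' fun _ =>
    forall_congr' fun _ => forall_congr' fun _ => forall_congr' fun _ => forall_congr' fun _ =>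
      BalancedTensor.map_injective_iff _ _

theorem isFlatRight_iff (N : Type u) [AddCommGroup N] [Module Rᵐᵒᵖ N] :
    IsFlatRight R N ↔ Flat (opAdd R).symm N :=
  forall_congr' fun _ => forall_congr' fun _ => forall_congr' fun _ => forall_congr' fun _ =>
    forall_congr' fun _ => forall_congr' fun _ => forall_congr' fun _ => forall_congr' fun _ =>
      (BalancedTensor.map_injective_iff _ _).trans extends_symm_iff.symm

end Tensor

/-! ### Resolutions -/

section Resolution

variable {S : Type u} [Ring S] {P : ModuleCat.{u} S → Prop} {M : Type u} [AddCommGroup M]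
  [Module S M]

theorem HasResolutionOfLength.mono {m n : ℕ} (h : HasResolutionOfLength S P M m) (hmn : m ≤ n) :
    HasResolutionOfLength S P M n := by
  obtain ⟨F, d, ε, h1, h2, h3, h4, h5⟩ := h
  exact ⟨F, d, ε, h1, h2, h3, h4, fun i hi => h5 i (hmn.trans_lt hi)⟩

theorem HasResolutionOfLength.exists_equiv (h : HasResolutionOfLength S P M 0) :
    ∃ F : ModuleCat.{u} S, P F ∧ Nonempty (F ≃ₗ[S] M) := by
  obtain ⟨F, d, ε, h1, h2, h3, -, h5⟩ := h
  refine ⟨F 0, h1 0, ⟨LinearEquiv.ofBijective ε ⟨?_, h2⟩⟩⟩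
  rw [injective_iff_map_eq_zero]
  intro a ha
  obtain ⟨b, rfl⟩ := (h3 a).1 ha
  have := h5 1 one_pos
  rw [Subsingleton.elim b 0, map_zero]

theorem HasResolutionOfLength.of_zero (h0 : P (ModuleCat.of S PUnit.{u + 1}))
    (h : P (ModuleCat.of S M)) : HasResolutionOfLength S P M 0 := by
  refine ⟨fun i => Nat.casesOn i (ModuleCat.of S M) fun _ => ModuleCat.of S PUnit.{u + 1},
    fun i => 0, LinearMap.id, ?_, Function.surjective_id, ?_, ?_, ?_⟩
  · rintro (_ | i)
    · exact h
    · exact h0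
  · intro x
    simp [eq_comm]
  · intro i x
    exact ⟨fun _ => ⟨0, rfl⟩, fun _ => rfl⟩
  · rintro (_ | i) hi
    · exact absurd hi (lt_irrefl 0)
    · exact inferInstanceAs (Subsingleton PUnit)

/-- Truncation at the augmentation; `HasResolutionOfLength.succ` is the converse splicing. -/
theorem HasResolutionOfLength.exists_succ {n : ℕ} (h : HasResolutionOfLength S P M (n + 1)) :
    ∃ (F : ModuleCat.{u} S) (f : F →ₗ[S] M), P F ∧ Function.Surjective f ∧
      HasResolutionOfLength S P (LinearMap.ker f) n := by
  obtain ⟨F, d, ε, h1, h2, h3, h4, h5⟩ := h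
  refine ⟨F 0, ε, h1 0, h2, fun i => F (i + 1), fun i => d (i + 1),
    (d 0).codRestrict _ fun x => h3.apply_apply_eq_zero x, fun i => h1 _, ?_, ?_,
    fun i => h4 (i + 1), fun i hi => h5 _ (by omega)⟩
  · rintro ⟨x, hx⟩
    obtain ⟨y, hy⟩ := (h3 x).1 hx
    exact ⟨y, Subtype.ext hy⟩
  · intro x
    rw [← h4 0 x]
    exact Subtype.ext_iff

theorem HasResolutionOfLength.succ {n : ℕ} {F : Type u} [AddCommGroup F] [Module S F]
    (hF : P (ModuleCat.of S F)) (f : F →ₗ[S] M) (hf : Function.Surjective f)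
    (h : HasResolutionOfLength S P (LinearMap.ker f) n) : HasResolutionOfLength S P M (n + 1) := by
  obtain ⟨F', d, ε, h1, h2, h3, h4, h5⟩ := h
  refine ⟨fun i => Nat.casesOn i (ModuleCat.of S F) F',
    fun i => Nat.casesOn i ((LinearMap.ker f).subtype ∘ₗ ε) d, f, ?_, hf, ?_, ?_, ?_⟩
  · rintro (_ | i)
    · exact hF
    · exact h1 i
  · intro x
    constructor
    · intro hx
      obtain ⟨y, hy⟩ := h2 ⟨x, hx⟩
      exact ⟨y, congrArg Subtype.val hy⟩
    · rintro ⟨y, rfl⟩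
      exact (ε y).2
  · rintro (_ | i)
    · intro x
      rw [← h3 x]
      exact (Subtype.ext_iff (a2 := (0 : LinearMap.ker f))).symm
    · exact h4 i
  · rintro (_ | i) hi
    · exact absurd hi (Nat.not_lt_zero _)
    · exact h5 i (by omega)

end Resolution

/-! ### Vanishing of the torsion functors -/

section Tor

variable {S T : Type u} [Ring S] [Ring T] {σ : S ≃+ T}

theorem Flat.of_equiv {M M' : Type u} [AddCommGroup M] [Module S M] [AddCommGroup M'] [Module S M']
    (h : Flat σ M) (e : M ≃ₗ[S] M') : Flat σ M' := by
  intro N N' _ _ _ _ f hf b hb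
  obtain ⟨b', h1, h2⟩ := h N N' f hf _ (hb.comp LinearMap.id e.toLinearMap)
  refine ⟨_, h1.comp LinearMap.id e.symm.toLinearMap, fun n m => (h2 n (e.symm m)).trans ?_⟩
  exact congrArg (b n) (e.apply_symm_apply m)

theorem flat_punit : Flat σ (PUnit.{u + 1} : Type u) := fun N N' _ _ _ _ f hf b hb =>
  ⟨0, fun _ _ _ => rfl, fun n m => by
    exact (show b n m = 0 by rw [Subsingleton.elim m 0, map_zero]).symm⟩

/-- `S`-modules with a flat resolution of length `n`. -/
abbrev HasFlatResolution (σ : S ≃+ T) (M : Type u) [AddCommGroup M] [Module S M] (n : ℕ) : Prop :=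
  HasResolutionOfLength S (fun F => Flat σ F) M n

theorem hasFlatResolution_zero_iff {M : Type u} [AddCommGroup M] [Module S M] :
    HasFlatResolution σ M 0 ↔ Flat σ M := by
  constructor
  · intro h
    obtain ⟨F, hF, ⟨e⟩⟩ := h.exists_equiv
    exact Flat.of_equiv hF e
  · exact fun h => HasResolutionOfLength.of_zero flat_punit h

/-- `Tor_{n + 1}(N, M) = 0`, by dimension shifting in `N`. -/
def TorVanishes (σ : S ≃+ T) : ℕ → ∀ (N : Type u) [AddCommGroup N] [Module T N]
    (M : Type u) [AddCommGroup M] [Module S M], Prop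
  | 0, N, _, _, M, _, _ => ∀ (G : Type u) [AddCommGroup G] [Module S G] (g : G →ₗ[S] M),
      Flat σ G → Function.Surjective g →
        Extends σ (LinearMap.id : N →ₗ[T] N) (LinearMap.ker g).subtype
  | n + 1, N, _, _, M, _, _ => ∀ (F : Type u) [AddCommGroup F] [Module T F] (f : F →ₗ[T] N),
      Flat σ.symm F → Function.Surjective f → TorVanishes σ n (LinearMap.ker f) M

variable {N : Type u} [AddCommGroup N] [Module T N] {M : Type u} [AddCommGroup M] [Module S M]

theorem exists_flat_cover (hσ : ∀ a b, σ (a * b) = σ b * σ a) (M : Type u) [AddCommGroup M]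
    [Module S M] : ∃ g : (M →₀ S) →ₗ[S] M, Flat σ (M →₀ S) ∧ Function.Surjective g :=
  ⟨Finsupp.linearCombination S id, flat_finsupp hσ M, Finsupp.linearCombination_id_surjective S M⟩

theorem TorVanishes.extends_ker (hσ : ∀ a b, σ (a * b) = σ b * σ a) (h : TorVanishes σ 0 N M)
    {F : Type u} [AddCommGroup F] [Module T F] (f : F →ₗ[T] N) (hf : Function.Surjective f) :
    Extends σ (LinearMap.ker f).subtype (LinearMap.id : M →ₗ[S] M) := by
  obtain ⟨g, hG, hg⟩ := exists_flat_cover hσ M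
  exact Extends.exchange hf hg (hG.extends_ker f) (h _ g hG hg)

/-- One flat cover of `N` decides the vanishing for all covers of `M`: this is the exchange with the
two sides swapped. -/
theorem torVanishes_zero_of_extends {F : Type u} [AddCommGroup F] [Module T F] (f : F →ₗ[T] N)
    (hF : Flat σ.symm F) (hf : Function.Surjective f)
    (h : Extends σ (LinearMap.ker f).subtype (LinearMap.id : M →ₗ[S] M)) :
    TorVanishes σ 0 N M := fun _ _ _ g _ hg =>
  extends_symm_iff.1 (Extends.exchange (σ := σ.symm) hg hf (hF.extends_ker g) h.flip)

theorem torVanishes_zero_iff_of_flat (hσ : ∀ a b, σ (a * b) = σ b * σ a) {G : Type u}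
    [AddCommGroup G] [Module S G] (g : G →ₗ[S] M) (hG : Flat σ G) (hg : Function.Surjective g) :
    TorVanishes σ 0 N M ↔ Extends σ (LinearMap.id : N →ₗ[T] N) (LinearMap.ker g).subtype := by
  refine ⟨fun h => h G g hG hg, fun h => ?_⟩
  obtain ⟨f, hF, hf⟩ := exists_flat_cover (σ := σ.symm) (symm_mul_rev hσ) N
  exact torVanishes_zero_of_extends f hF hf (Extends.exchange hf hg (hG.extends_ker f) h)

/-- Dimension shifting for `Tor₁` along `ker f ⊆ F` and `ker g ⊆ G` with `F` and `G` flat. -/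
theorem torVanishes_zero_ker_iff (hσ : ∀ a b, σ (a * b) = σ b * σ a) {F : Type u} [AddCommGroup F]
    [Module T F] (f : F →ₗ[T] N) (hF : Flat σ.symm F) (hf : Function.Surjective f) {G : Type u}
    [AddCommGroup G] [Module S G] (g : G →ₗ[S] M) (hG : Flat σ G) (hg : Function.Surjective g) :
    TorVanishes σ 0 N (LinearMap.ker g) ↔ TorVanishes σ 0 (LinearMap.ker f) M := by
  have hFg : Extends σ (LinearMap.id : F →ₗ[T] F) (LinearMap.ker g).subtype :=
    extends_symm_iff.1 (hF.extends_ker g)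
  have hGf : Extends σ (LinearMap.ker f).subtype (LinearMap.id : G →ₗ[S] G) := hG.extends_ker f
  rw [torVanishes_zero_iff_of_flat hσ g hG hg]
  constructor
  -- Both paths around the square from `ker f ⊗ ker g` to `F ⊗ G` have the same composite.
  -- Injectivity along one path gives injectivity of the first map of the other.
  · intro h
    have h1 := hFg.comp (h.extends_ker hσ f hf)
    exact Extends.of_comp (f' := (LinearMap.ker f).subtype) (g' := LinearMap.id) h1
  · intro h
    have h1 := hGf.comp h
    exact torVanishes_zero_of_extends f hF hf
      (Extends.of_comp (f' := LinearMap.id) (g' := (LinearMap.ker g).subtype) h1)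

/-- `TorVanishes` shifts in `N` by definition, whereas this shifts in `M`. The two shifts act on
different arguments, so only the case `n = 0` has content. -/
theorem torVanishes_ker_iff (hσ : ∀ a b, σ (a * b) = σ b * σ a) {G : Type u}
    [AddCommGroup G] [Module S G] (g : G →ₗ[S] M) (hG : Flat σ G) (hg : Function.Surjective g)
    (n : ℕ) : TorVanishes σ n N (LinearMap.ker g) ↔ TorVanishes σ (n + 1) N M := by
  induction n generalizing N with
  | zero =>
    constructor
    · exact fun h F _ _ f hF hf => (torVanishes_zero_ker_iff hσ f hF hf g hG hg).1 h
    · intro h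
      obtain ⟨f, hF, hf⟩ := exists_flat_cover (σ := σ.symm) (symm_mul_rev hσ) N
      exact (torVanishes_zero_ker_iff hσ f hF hf g hG hg).2 (h _ f hF hf)
  | succ n ih =>
    exact forall_congr' fun F => forall_congr' fun _ => forall_congr' fun _ =>
      forall_congr' fun f => forall_congr' fun _ => forall_congr' fun _ => ih

theorem Flat.torVanishes_zero (h : Flat σ M) (hσ : ∀ a b, σ (a * b) = σ b * σ a) :
    TorVanishes σ 0 N M := by
  obtain ⟨f, hF, hf⟩ := exists_flat_cover (σ := σ.symm) (symm_mul_rev hσ) N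
  exact torVanishes_zero_of_extends f hF hf (h.extends_ker f)

theorem HasFlatResolution.torVanishes (hσ : ∀ a b, σ (a * b) = σ b * σ a) {n : ℕ}
    {M : Type u} [AddCommGroup M] [Module S M] (h : HasFlatResolution σ M n) :
    TorVanishes σ n N M := by
  induction n generalizing M with
  | zero => exact (hasFlatResolution_zero_iff.1 h).torVanishes_zero hσ
  | succ n ih =>
    obtain ⟨F, f, hF, hf, hr⟩ := h.exists_succ
    exact (torVanishes_ker_iff hσ f hF hf n).1 (ih hr)

end Tor

/-! ### Components of an internal direct sum -/

section Components

variable {Γ : Type x} [DecidableEq Γ] {M : Type v} [AddCommGroup M] {𝓜 : Γ → AddSubgroup M}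

/-- The projection of an internal direct sum onto a summand. -/
noncomputable def component (h : DirectSum.IsInternal 𝓜) (δ : Γ) : M →+ M :=
  ((𝓜 δ).subtype.comp (DFinsupp.evalAddMonoidHom δ)).comp
    (AddEquiv.ofBijective (DirectSum.coeAddMonoidHom 𝓜) h).symm.toAddMonoidHom

theorem component_mem (h : DirectSum.IsInternal 𝓜) (δ : Γ) (m : M) : component h δ m ∈ 𝓜 δ :=
  SetLike.coe_mem _

theorem ofBijective_symm_of_mem (h : DirectSum.IsInternal 𝓜) {δ : Γ} {m : M} (hm : m ∈ 𝓜 δ) :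
    (AddEquiv.ofBijective (DirectSum.coeAddMonoidHom 𝓜) h).symm m =
      DirectSum.of (fun i => 𝓜 i) δ ⟨m, hm⟩ := by
  rw [AddEquiv.symm_apply_eq]
  exact (DirectSum.coeAddMonoidHom_of 𝓜 δ ⟨m, hm⟩).symm

theorem component_of_mem (h : DirectSum.IsInternal 𝓜) {δ : Γ} {m : M} (hm : m ∈ 𝓜 δ) :
    component h δ m = m := by
  change (((AddEquiv.ofBijective (DirectSum.coeAddMonoidHom 𝓜) h).symm m δ : 𝓜 δ) : M) = m
  rw [ofBijective_symm_of_mem h hm, DirectSum.of_eq_same]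

theorem component_of_mem_ne (h : DirectSum.IsInternal 𝓜) {δ δ' : Γ} {m : M} (hm : m ∈ 𝓜 δ)
    (hne : δ ≠ δ') : component h δ' m = 0 := by
  change (((AddEquiv.ofBijective (DirectSum.coeAddMonoidHom 𝓜) h).symm m δ' : 𝓜 δ') : M) = 0
  rw [ofBijective_symm_of_mem h hm, DirectSum.of_eq_of_ne _ _ _ hne.symm]
  rfl

theorem exists_sum_component (h : DirectSum.IsInternal 𝓜) (m : M) :
    ∃ s : Finset Γ, ∑ δ ∈ s, component h δ m = m := by
  classical
  refine ⟨DFinsupp.support ((AddEquiv.ofBijective (DirectSum.coeAddMonoidHom 𝓜) h).symm m), ?_⟩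
  conv_rhs => rw [← (AddEquiv.ofBijective (DirectSum.coeAddMonoidHom 𝓜) h).apply_symm_apply m]
  exact (DirectSum.coeAddMonoidHom_eq_dfinsuppSum 𝓜 _).symm

/-- The maps `p δ` read off the coordinates of a sum, so the summands are independent. -/
theorem isInternal_of_components (p : Γ → M →+ M) (h1 : ∀ δ, ∀ m ∈ 𝓜 δ, p δ m = m)
    (h2 : ∀ δ δ', δ ≠ δ' → ∀ m ∈ 𝓜 δ, p δ' m = 0) (h3 : ∀ m, m ∈ ⨆ δ, 𝓜 δ) :
    DirectSum.IsInternal 𝓜 := by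
  have key : ∀ (y : DirectSum Γ fun i => 𝓜 i) δ, p δ (DirectSum.coeAddMonoidHom 𝓜 y) = y δ := by
    intro y δ
    induction y using DirectSum.induction_on with
    | zero => simp
    | of i z =>
      rw [DirectSum.coeAddMonoidHom_of]
      by_cases hi : i = δ
      · subst hi
        rw [DirectSum.of_eq_same, h1 _ _ z.2]
      · rw [DirectSum.of_eq_of_ne _ _ _ (Ne.symm hi), h2 _ _ hi _ z.2]
        rfl
    | add y z hy hz => simp [hy, hz]
  constructor
  · rw [injective_iff_map_eq_zero]
    intro y hy
    ext δ
    rw [← key, hy, map_zero]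
    rfl
  · intro m
    induction h3 m using AddSubgroup.iSup_induction' with
    | hp δ m hm => exact ⟨DirectSum.of (fun i => 𝓜 i) δ ⟨m, hm⟩, DirectSum.coeAddMonoidHom_of ..⟩
    | h1 => exact ⟨0, map_zero _⟩
    | hadd y z _ _ hy hz =>
      obtain ⟨a, ha⟩ := hy
      obtain ⟨b, hb⟩ := hz
      exact ⟨a + b, by rw [map_add, ha, hb]⟩

theorem mem_iSup_of_isInternal (h : DirectSum.IsInternal 𝓜) (m : M) : m ∈ ⨆ δ, 𝓜 δ := by
  obtain ⟨s, hs⟩ := exists_sum_component h m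
  rw [← hs]
  exact sum_mem fun δ _ => (le_iSup 𝓜 δ) (component_mem h δ m)

/-- Injectivity of `θ` keeps distinct degrees from colliding. It is applied with `θ` the identity
for graded maps, and with `θ = op α` for multiplication by an element of degree `α`, where left
cancellation enters. -/
theorem map_component {M' : Type w} [AddCommGroup M'] {𝓜' : Γ → AddSubgroup M'}
    (h : DirectSum.IsInternal 𝓜) (h' : DirectSum.IsInternal 𝓜') (f : M →+ M') {θ : Γ → Γ}
    (hθ : Function.Injective θ) (hf : ∀ δ, ∀ m ∈ 𝓜 δ, f m ∈ 𝓜' (θ δ)) (δ : Γ) (m : M) :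
    component h' (θ δ) (f m) = f (component h δ m) := by
  induction mem_iSup_of_isInternal h m using AddSubgroup.iSup_induction' with
  | hp β m hm =>
    by_cases hβ : β = δ
    · subst hβ
      rw [component_of_mem h hm, component_of_mem h' (hf _ _ hm)]
    · rw [component_of_mem_ne h hm hβ, component_of_mem_ne h' (hf _ _ hm) (hθ.ne hβ), map_zero]
  | h1 => simp
  | hadd y z _ _ hy hz => simp [hy, hz]

end Components

/-! ### Shifts along a cancellative operation -/

/-- A cancellative monoid operation, used for a monoid and its opposite alike. -/
structure IsCancelOp {Γ : Type x} (op : Γ → Γ → Γ) (e : Γ) : Prop where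
  assoc : ∀ a b c, op (op a b) c = op a (op b c)
  id_left : ∀ a, op e a = a
  left_injective : ∀ a, Function.Injective (op a)
  right_injective : ∀ b, Function.Injective fun a => op a b

section Shift

variable {Γ : Type x} {S : Type u} [Ring S] {op : Γ → Γ → Γ} {e : Γ} {𝒜 : Γ → AddSubgroup S}

open Classical in
/-- The elements of `S` that have degree `δ` when the generator `1` is given degree `β`. -/
noncomputable def shift (op : Γ → Γ → Γ) (𝒜 : Γ → AddSubgroup S) (β δ : Γ) : AddSubgroup S :=
  if h : ∃ α, op α β = δ then 𝒜 h.choose else ⊥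

/-- Right cancellation makes the chosen degree unique. In a monoid `δ` need not be a multiple of
`β`, and then the component is zero. -/
theorem shift_op (hop : IsCancelOp op e) (α β : Γ) : shift op 𝒜 β (op α β) = 𝒜 α := by
  have h : ∃ α', op α' β = op α β := ⟨α, rfl⟩
  rw [shift, dif_pos h, hop.right_injective β h.choose_spec]

theorem mem_shift (hop : IsCancelOp op e) {β δ : Γ} {r : S} :
    r ∈ shift op 𝒜 β δ ↔ r = 0 ∨ ∃ α, op α β = δ ∧ r ∈ 𝒜 α := by
  constructor
  · intro hr
    by_cases h : ∃ α, op α β = δ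
    · obtain ⟨α, rfl⟩ := h
      exact Or.inr ⟨α, rfl, by rwa [shift_op hop] at hr⟩
    · rw [shift, dif_neg h] at hr
      exact Or.inl hr
  · rintro (rfl | ⟨α, rfl, hr⟩)
    · exact zero_mem _
    · rwa [shift_op hop]

end Shift

/-! ### Graded modules over a cancellative operation -/

section Graded

variable {Γ : Type x} [DecidableEq Γ]

variable {S : Type u} [Ring S]

/-- `𝓜` is a grading of `M` over the ring grading `𝒜`, with degrees multiplied by `op`. -/
structure IsGradedModule (op : Γ → Γ → Γ) (𝒜 : Γ → AddSubgroup S) {M : Type v} [AddCommGroup M]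
    [Module S M] (𝓜 : Γ → AddSubgroup M) : Prop where
  isInternal : DirectSum.IsInternal 𝓜
  smul_mem : ∀ (α β : Γ) (r : S) (m : M), r ∈ 𝒜 α → m ∈ 𝓜 β → r • m ∈ 𝓜 (op α β)

/-- `𝒜` is a ring grading of `S`, with degrees multiplied by the cancellative operation `op`. -/
structure IsRingGrading (op : Γ → Γ → Γ) (e : Γ) (𝒜 : Γ → AddSubgroup S) : Prop
    extends IsCancelOp op e, IsGradedModule op 𝒜 𝒜 where
  one_mem : (1 : S) ∈ 𝒜 e

variable {op : Γ → Γ → Γ} {e : Γ} {𝒜 : Γ → AddSubgroup S}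
variable {M : Type v} [AddCommGroup M] [Module S M] {𝓜 : Γ → AddSubgroup M}

theorem IsGradedModule.component_smul (hop : IsCancelOp op e) (h : IsGradedModule op 𝒜 𝓜) {α : Γ}
    {r : S} (hr : r ∈ 𝒜 α) (β : Γ) (m : M) :
    component h.isInternal (op α β) (r • m) = r • component h.isInternal β m :=
  map_component h.isInternal h.isInternal (DistribSMul.toAddMonoidHom M r) (hop.left_injective α)
    (fun β m hm => h.smul_mem α β r m hr hm) β m

theorem IsGradedModule.component_mem_span (hA : DirectSum.IsInternal 𝒜)
    (h : IsGradedModule op 𝒜 𝓜) {s : Set M} (hs : ∀ m ∈ s, ∃ δ, m ∈ 𝓜 δ) (δ : Γ) {m : M}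
    (hm : m ∈ Submodule.span S s) : component h.isInternal δ m ∈ Submodule.span S s := by
  induction hm using Submodule.span_induction generalizing δ with
  | mem m hm =>
    obtain ⟨β, hβ⟩ := hs m hm
    by_cases hδ : β = δ
    · subst hδ
      rw [component_of_mem _ hβ]
      exact Submodule.subset_span hm
    · rw [component_of_mem_ne _ hβ hδ]
      exact zero_mem _
  | zero => rw [map_zero]; exact zero_mem _
  | add y z _ _ hy hz => rw [map_add]; exact add_mem (hy δ) (hz δ)
  | smul r m _ hm =>
    obtain ⟨t, ht⟩ := exists_sum_component h.isInternal m
    obtain ⟨t', ht'⟩ := exists_sum_component hA r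
    rw [← ht, ← ht', Finset.sum_smul, map_sum]
    refine sum_mem fun α _ => ?_
    rw [Finset.smul_sum, map_sum]
    refine sum_mem fun β _ => ?_
    have h1 := h.smul_mem α β _ _ (component_mem hA α r) (component_mem h.isInternal β m)
    by_cases hδ : op α β = δ
    · subst hδ
      rw [component_of_mem _ h1]
      exact Submodule.smul_mem _ _ (hm β)
    · rw [component_of_mem_ne _ h1 hδ]
      exact zero_mem _

theorem IsGradedModule.submodule (h : IsGradedModule op 𝒜 𝓜) (K : Submodule S M)
    (hK : ∀ δ, ∀ m ∈ K, component h.isInternal δ m ∈ K) :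
    IsGradedModule op 𝒜 fun δ => (𝓜 δ).comap K.subtype.toAddMonoidHom where
  isInternal := by
    let p : Γ → K →+ K := fun δ =>
      ((component h.isInternal δ).comp K.subtype.toAddMonoidHom).codRestrict K
        fun m => hK δ m m.2
    refine isInternal_of_components p (fun δ m hm => Subtype.ext (component_of_mem _ hm))
      (fun δ δ' hne m hm => Subtype.ext (component_of_mem_ne _ hm hne)) fun m => ?_
    obtain ⟨s, hs⟩ := exists_sum_component h.isInternal (m : M)
    have : m = ∑ δ ∈ s, p δ m := Subtype.ext (by
      rw [AddSubmonoidClass.coe_finsetSum]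
      exact hs.symm)
    rw [this]
    exact sum_mem fun δ _ => AddSubgroup.mem_iSup_of_mem δ (component_mem h.isInternal δ m)
  smul_mem α β r m hr hm := h.smul_mem α β r m hr hm

theorem IsGradedModule.quotient (h : IsGradedModule op 𝒜 𝓜) (K : Submodule S M)
    (hK : ∀ δ, ∀ m ∈ K, component h.isInternal δ m ∈ K) :
    IsGradedModule op 𝒜 fun δ => (𝓜 δ).map K.mkQ.toAddMonoidHom where
  isInternal := by
    have hp : ∀ δ, ∃ c : M ⧸ K →+ M ⧸ K, ∀ m, c (K.mkQ m) = K.mkQ (component h.isInternal δ m) :=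
      fun δ => exists_descent_of_surjective K.mkQ.toAddMonoidHom K.mkQ_surjective
        (K.mkQ.toAddMonoidHom.comp (component h.isInternal δ)) fun m hm => by
          have hm' : m ∈ K := (Submodule.Quotient.mk_eq_zero K).1 hm
          exact (Submodule.Quotient.mk_eq_zero K).2 (hK δ m hm')
    choose p hp using hp
    refine isInternal_of_components p ?_ ?_ fun m => ?_
    · rintro δ _ ⟨m, hm, rfl⟩
      exact (hp δ m).trans (congrArg K.mkQ (component_of_mem _ hm))
    · rintro δ δ' hne _ ⟨m, hm, rfl⟩
      exact (hp δ' m).trans ((congrArg K.mkQ (component_of_mem_ne _ hm hne)).trans (map_zero _))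
    · obtain ⟨m, rfl⟩ := K.mkQ_surjective m
      obtain ⟨s, hs⟩ := exists_sum_component h.isInternal m
      rw [← hs, map_sum]
      exact sum_mem fun δ _ => AddSubgroup.mem_iSup_of_mem δ
        ⟨_, component_mem h.isInternal δ m, rfl⟩
  smul_mem α β r m hr hm := by
    obtain ⟨m, hm, rfl⟩ := hm
    exact ⟨r • m, h.smul_mem α β r m hr hm, rfl⟩

/-! ### Graded free modules -/

/-- The grading of the free module on `ι` in which the basis vector `i` has degree `deg i`. -/
noncomputable def freeGrading (op : Γ → Γ → Γ) (𝒜 : Γ → AddSubgroup S) {ι : Type w} (deg : ι → Γ)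
    (δ : Γ) : AddSubgroup (ι →₀ S) where
  carrier := {f | ∀ i, f i ∈ shift op 𝒜 (deg i) δ}
  zero_mem' _ := zero_mem _
  add_mem' hf hg i := add_mem (hf i) (hg i)
  neg_mem' hf i := neg_mem (hf i)

theorem single_mem_freeGrading (h : IsRingGrading op e 𝒜) {ι : Type w} (deg : ι → Γ) (i : ι)
    {α : Γ} {r : S} (hr : r ∈ 𝒜 α) :
    Finsupp.single i r ∈ freeGrading op 𝒜 deg (op α (deg i)) := fun j => by
  classical
  rw [Finsupp.single_apply]
  split_ifs with hj
  · subst hj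
    rwa [shift_op h.toIsCancelOp]
  · exact zero_mem _

theorem isGradedModule_freeGrading (h : IsRingGrading op e 𝒜) {ι : Type w} (deg : ι → Γ) :
    IsGradedModule op 𝒜 (freeGrading op 𝒜 deg) where
  isInternal := by
    classical
    -- `q β δ` projects onto the component of the unique degree `α` with `op α β = δ`, and is zero
    -- if there is none; the projections of the free module apply it coordinatewise.
    let q : Γ → Γ → S →+ S := fun β δ =>
      if h' : ∃ α, op α β = δ then component h.isInternal h'.choose else 0
    have q1 : ∀ β δ, ∀ r ∈ shift op 𝒜 β δ, q β δ r = r := by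
      intro β δ r hr
      simp only [shift, q] at hr ⊢
      split_ifs at hr ⊢ with h'
      · exact component_of_mem _ hr
      · exact (AddSubgroup.mem_bot.1 hr).symm
    have q2 : ∀ β δ δ', δ ≠ δ' → ∀ r ∈ shift op 𝒜 β δ, q β δ' r = 0 := by
      intro β δ δ' hne r hr
      rcases (mem_shift h.toIsCancelOp).1 hr with rfl | ⟨α, rfl, hα⟩
      · exact map_zero _
      · simp only [q]
        split_ifs with h'
        · refine component_of_mem_ne _ hα fun hc => hne ?_
          have := h'.choose_spec
          rwa [← hc] at this
        · rfl
    refine isInternal_of_components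
      (fun δ => Finsupp.liftAddHom fun i => (Finsupp.singleAddHom i).comp (q (deg i) δ)) ?_ ?_ ?_
    · intro δ f hf
      conv_rhs => rw [← Finsupp.sum_single f]
      rw [Finsupp.liftAddHom_apply]
      exact Finsupp.sum_congr fun i _ => congrArg (Finsupp.single i) (q1 _ _ _ (hf i))
    · intro δ δ' hne f hf
      rw [Finsupp.liftAddHom_apply]
      refine Finset.sum_eq_zero fun i _ => ?_
      exact (congrArg (Finsupp.single i) (q2 _ _ _ hne _ (hf i))).trans (Finsupp.single_zero i)
    · intro f
      induction f using Finsupp.induction_linear with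
      | zero => exact zero_mem _
      | add f g hf hg => exact add_mem hf hg
      | single i r =>
        obtain ⟨s, hs⟩ := exists_sum_component h.isInternal r
        rw [← hs, Finsupp.single_finsetSum]
        exact sum_mem fun α _ => AddSubgroup.mem_iSup_of_mem _
          (single_mem_freeGrading h deg i (component_mem h.isInternal α r))
  smul_mem α β r f hr hf i := by
    rw [Finsupp.smul_apply]
    rcases (mem_shift h.toIsCancelOp).1 (hf i) with h0 | ⟨γ, rfl, hγ⟩
    · rw [h0, smul_zero]
      exact zero_mem _
    · rw [← h.assoc, shift_op h.toIsCancelOp]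
      exact h.smul_mem α γ r _ hr hγ

theorem linearCombination_mem (h : IsRingGrading op e 𝒜) (hM : IsGradedModule op 𝒜 𝓜)
    {ι : Type w} {deg : ι → Γ} {b : ι → M} (hb : ∀ i, b i ∈ 𝓜 (deg i)) (δ : Γ) (f : ι →₀ S)
    (hf : f ∈ freeGrading op 𝒜 deg δ) : Finsupp.linearCombination S b f ∈ 𝓜 δ := by
  rw [Finsupp.linearCombination_apply]
  refine sum_mem fun i _ => ?_
  rcases (mem_shift h.toIsCancelOp).1 (hf i) with h0 | ⟨γ, rfl, hγ⟩
  · change f i • b i ∈ _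
    rw [h0, zero_smul]
    exact zero_mem _
  · exact hM.smul_mem γ _ _ _ hγ (hb i)

theorem component_mem_ker (h : IsRingGrading op e 𝒜) (hM : IsGradedModule op 𝒜 𝓜)
    {ι : Type w} {deg : ι → Γ} {b : ι → M} (hb : ∀ i, b i ∈ 𝓜 (deg i)) (δ : Γ) (f : ι →₀ S)
    (hf : f ∈ LinearMap.ker (Finsupp.linearCombination S b)) :
    component (isGradedModule_freeGrading h deg).isInternal δ f ∈
      LinearMap.ker (Finsupp.linearCombination S b) := by
  have := map_component (isGradedModule_freeGrading h deg).isInternal hM.isInternal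
    (Finsupp.linearCombination S b).toAddMonoidHom Function.injective_id
    (linearCombination_mem h hM hb) δ f
  refine this.symm.trans ?_
  change component hM.isInternal δ (Finsupp.linearCombination S b f) = 0
  rw [LinearMap.mem_ker.1 hf, map_zero]

/-- A graded module is a quotient of a free module by a graded map. -/
theorem IsGradedModule.exists_cover (h : IsGradedModule op 𝒜 𝓜) :
    ∃ (ι : Type v) (deg : ι → Γ) (b : ι → M), (∀ i, b i ∈ 𝓜 (deg i)) ∧
      Function.Surjective (Finsupp.linearCombination S b) := by
  refine ⟨{m : M // ∃ δ, m ∈ 𝓜 δ}, fun i => i.2.choose, Subtype.val, fun i => i.2.choose_spec, ?_⟩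
  rw [← LinearMap.range_eq_top, Finsupp.range_linearCombination, eq_top_iff]
  rintro m -
  obtain ⟨s, hs⟩ := exists_sum_component h.isInternal m
  rw [← hs]
  exact sum_mem fun δ _ => Submodule.subset_span
    ⟨⟨_, δ, component_mem h.isInternal δ m⟩, rfl⟩

end Graded

/-! ### Flat and projective graded modules, tested on homogeneous ideals -/

section Flatness

variable {Γ : Type x} [DecidableEq Γ] {S T : Type u} [Ring S] [Ring T] {σ : S ≃+ T}
variable {op : Γ → Γ → Γ} {e : Γ} {𝒜 : Γ → AddSubgroup S}
variable {M : Type u} [AddCommGroup M] [Module S M] {𝓜 : Γ → AddSubgroup M}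

/-- `J ⊗ M → M` is injective for every one-sided ideal `J` generated by finitely many homogeneous
elements. -/
def ExtendsFromHomogeneousIdeals (σ : S ≃+ T) (𝒜 : Γ → AddSubgroup S) (M : Type u)
    [AddCommGroup M] [Module S M] : Prop :=
  ∀ (κ : Type u) [Fintype κ] (r : κ → S), (∀ i, ∃ α, r i ∈ 𝒜 α) →
    Extends σ (Submodule.span T (Set.range fun i => σ (r i))).subtype (LinearMap.id : M →ₗ[S] M)

/-- The coefficients of `l` are homogeneous, so the relation they impose on the generators `b i`
lifts to the free module. Sending the basis vectors in the support of `l` to the lifts, and fixing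
the others, kills `l` without changing the map to `M`. The endomorphism is kept graded so that the
construction can be iterated. -/
theorem exists_graded_endomorphism_of_mem_ker (hσ : ∀ a b, σ (a * b) = σ b * σ a)
    (h : IsRingGrading op e 𝒜) (hM : IsGradedModule op 𝒜 𝓜)
    (hJ : ExtendsFromHomogeneousIdeals σ 𝒜 M) {ι : Type u} {deg : ι → Γ} {b : ι → M}
    (hb : ∀ i, b i ∈ 𝓜 (deg i)) (hs : Function.Surjective (Finsupp.linearCombination S b))
    {δ : Γ} {l : ι →₀ S} (hl : l ∈ freeGrading op 𝒜 deg δ)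
    (hl0 : Finsupp.linearCombination S b l = 0) :
    ∃ φ : (ι →₀ S) →ₗ[S] (ι →₀ S),
      Finsupp.linearCombination S b ∘ₗ φ = Finsupp.linearCombination S b ∧
      (∀ δ, ∀ f ∈ freeGrading op 𝒜 deg δ, φ f ∈ freeGrading op 𝒜 deg δ) ∧ φ l = 0 := by
  classical
  set π := Finsupp.linearCombination S b with hπ
  have hG := isGradedModule_freeGrading h deg
  have hα : ∀ i : l.support, ∃ α, op α (deg i) = δ ∧ l i ∈ 𝒜 α := fun i =>
    ((mem_shift h.toIsCancelOp).1 (hl i)).resolve_left (Finsupp.mem_support_iff.1 i.2)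
  choose α hαδ hα using hα
  obtain ⟨g, hg, hg0⟩ := exists_lift_of_extends hσ π hs (fun i : l.support => l i)
    (hJ _ _ fun i => ⟨α i, hα i⟩) (fun i => b i) (by
      rw [← hl0, hπ, Finsupp.linearCombination_apply, Finsupp.sum]
      exact Finset.sum_coe_sort l.support fun i => l i • b i)
  -- Only the part of `g i` in degree `deg i` is kept. Since `op (α i) (deg i) = δ`, the new
  -- relation is the degree `δ` part of the old one.
  let g' : l.support → ι →₀ S := fun i => component hG.isInternal (deg i) (g i)
  have hg' : ∀ i, π (g' i) = b i := fun i => by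
    have := map_component hG.isInternal hM.isInternal π.toAddMonoidHom Function.injective_id
      (linearCombination_mem h hM hb) (deg i) (g i)
    refine this.symm.trans ?_
    change component hM.isInternal (deg i) (π (g i)) = b i
    rw [hg, component_of_mem _ (hb i)]
  have hg0' : ∑ i : l.support, l i • g' i = 0 := by
    have h1 : ∀ i : l.support, l i • g' i = component hG.isInternal δ (l i • g i) := fun i => by
      rw [← hαδ i, hG.component_smul h.toIsCancelOp (hα i)]
    rw [Finset.sum_congr rfl fun i _ => h1 i, ← map_sum, hg0, map_zero]
  let c : ι → ι →₀ S := fun i => if hi : i ∈ l.support then g' ⟨i, hi⟩ else Finsupp.single i 1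
  have hc : ∀ i, c i ∈ freeGrading op 𝒜 deg (deg i) := fun i => by
    simp only [c]
    split_ifs with hi
    · exact component_mem hG.isInternal _ _
    · have := single_mem_freeGrading h deg i h.one_mem
      rwa [h.id_left] at this
  refine ⟨Finsupp.linearCombination S c, ?_, linearCombination_mem h hG hc, ?_⟩
  · refine Finsupp.lhom_ext' fun i => LinearMap.ext_ring ?_
    simp only [LinearMap.comp_apply, Finsupp.lsingle_apply, Finsupp.linearCombination_single,
      one_smul, c, hπ]
    split_ifs with hi
    · exact hg' ⟨i, hi⟩
    · simp
  · rw [Finsupp.linearCombination_apply, Finsupp.sum, ← Finset.sum_coe_sort, ← hg0']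
    exact Finset.sum_congr rfl fun i _ => by simp only [c, dif_pos i.2]

theorem exists_endomorphism_of_subset_ker (hσ : ∀ a b, σ (a * b) = σ b * σ a)
    (h : IsRingGrading op e 𝒜) (hM : IsGradedModule op 𝒜 𝓜)
    (hJ : ExtendsFromHomogeneousIdeals σ 𝒜 M) {ι : Type u} {deg : ι → Γ} {b : ι → M}
    (hb : ∀ i, b i ∈ 𝓜 (deg i)) (hs : Function.Surjective (Finsupp.linearCombination S b))
    (s : Finset (ι →₀ S)) (hs0 : ∀ l ∈ s, Finsupp.linearCombination S b l = 0) :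
    ∃ φ : (ι →₀ S) →ₗ[S] (ι →₀ S),
      Finsupp.linearCombination S b ∘ₗ φ = Finsupp.linearCombination S b ∧ ∀ l ∈ s, φ l = 0 := by
  classical
  have key : ∀ t : Finset (ι →₀ S),
      (∀ l ∈ t, Finsupp.linearCombination S b l = 0 ∧ ∃ δ, l ∈ freeGrading op 𝒜 deg δ) →
      ∃ φ : (ι →₀ S) →ₗ[S] (ι →₀ S),
        Finsupp.linearCombination S b ∘ₗ φ = Finsupp.linearCombination S b ∧
        (∀ δ, ∀ f ∈ freeGrading op 𝒜 deg δ, φ f ∈ freeGrading op 𝒜 deg δ) ∧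
        ∀ l ∈ t, φ l = 0 := by
    intro t
    induction t using Finset.induction_on with
    | empty => exact fun _ => ⟨LinearMap.id, rfl, fun _ _ hf => hf, by simp⟩
    | insert l t _ ih =>
      intro ht
      obtain ⟨φ, h1, h2, h3⟩ := ih fun l hl => ht l (Finset.mem_insert_of_mem hl)
      obtain ⟨hl0, δ, hl⟩ := ht l (Finset.mem_insert_self l t)
      -- `ψ` is chosen to kill `φ l` rather than `l`, so that the composite kills both `l` and `t`;
      -- `φ l` is still homogeneous and in the kernel.
      obtain ⟨ψ, h4, h5, h6⟩ := exists_graded_endomorphism_of_mem_ker hσ h hM hJ hb hs (h2 δ l hl)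
        ((LinearMap.congr_fun h1 l).trans hl0)
      refine ⟨ψ ∘ₗ φ, by rw [← LinearMap.comp_assoc, h4, h1],
        fun δ f hf => h5 δ _ (h2 δ f hf), fun l' hl' => ?_⟩
      rcases Finset.mem_insert.1 hl' with rfl | hl'
      · exact h6
      · rw [LinearMap.comp_apply, h3 l' hl', map_zero]
  have hG := (isGradedModule_freeGrading h deg).isInternal
  choose D hD using exists_sum_component hG
  -- Arbitrary kernel elements are replaced by their components, which remain in the kernel because
  -- the cover is graded.
  obtain ⟨φ, h1, -, h3⟩ := key (s.biUnion fun l => (D l).image fun δ => component hG δ l) (by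
    intro l hl
    obtain ⟨l', hl', hl⟩ := Finset.mem_biUnion.1 hl
    obtain ⟨δ, -, rfl⟩ := Finset.mem_image.1 hl
    exact ⟨component_mem_ker h hM hb δ l' (hs0 l' hl'), δ, component_mem hG δ l'⟩)
  refine ⟨φ, h1, fun l hl => ?_⟩
  rw [← hD l, map_sum]
  exact Finset.sum_eq_zero fun δ hδ =>
    h3 _ (Finset.mem_biUnion.2 ⟨l, hl, Finset.mem_image_of_mem _ hδ⟩)

/-- Flatness of a graded module can be tested on finitely generated homogeneous ideals. -/
theorem IsGradedModule.flat (hσ : ∀ a b, σ (a * b) = σ b * σ a)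
    (h : IsRingGrading op e 𝒜) (hM : IsGradedModule op 𝒜 𝓜)
    (hJ : ExtendsFromHomogeneousIdeals σ 𝒜 M) : Flat σ M := by
  obtain ⟨ι, deg, b, hb, hs⟩ := hM.exists_cover
  refine flat_of_lifts hσ (Finsupp.linearCombination S b) fun κ s r m hm => ?_
  choose y hy using fun i => hs (m i)
  obtain ⟨φ, h1, h2⟩ := exists_endomorphism_of_subset_ker hσ h hM hJ hb hs {∑ i ∈ s, r i • y i}
    (by simpa [hy] using hm)
  refine ⟨fun i => φ (y i), fun i _ => (LinearMap.congr_fun h1 (y i)).trans (hy i), ?_⟩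
  simpa using h2 _ (Finset.mem_singleton_self _)

/-- Finite presentation makes the kernel of the cover finitely generated, so a single endomorphism
over `M` kills all of it and induces a splitting. -/
theorem IsGradedModule.projective (hσ : ∀ a b, σ (a * b) = σ b * σ a)
    (h : IsRingGrading op e 𝒜) (hM : IsGradedModule op 𝒜 𝓜)
    (hJ : ExtendsFromHomogeneousIdeals σ 𝒜 M) {ι : Type u} [Finite ι] {deg : ι → Γ} {b : ι → M}
    (hb : ∀ i, b i ∈ 𝓜 (deg i)) (hs : Function.Surjective (Finsupp.linearCombination S b))
    [Module.FinitePresentation S M] : Module.Projective S M := by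
  obtain ⟨t, ht⟩ := Module.FinitePresentation.fg_ker (Finsupp.linearCombination S b) hs
  obtain ⟨φ, h1, h2⟩ := exists_endomorphism_of_subset_ker hσ h hM hJ hb hs t fun l hl =>
    LinearMap.mem_ker.1 (ht ▸ Submodule.subset_span hl)
  have hφ : LinearMap.ker (Finsupp.linearCombination S b) ≤ LinearMap.ker φ := by
    rw [← ht]
    exact Submodule.span_le.2 h2
  refine Module.Projective.of_split
    (Submodule.liftQ _ φ hφ ∘ₗ ((Finsupp.linearCombination S b).quotKerEquivOfSurjective hs).symm)
    (Finsupp.linearCombination S b) (LinearMap.ext fun m => ?_)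
  obtain ⟨y, rfl⟩ := hs m
  have : ((Finsupp.linearCombination S b).quotKerEquivOfSurjective hs).symm
      (Finsupp.linearCombination S b y) = Submodule.Quotient.mk y := by
    rw [LinearEquiv.symm_apply_eq]
    rfl
  rw [LinearMap.comp_apply, LinearMap.comp_apply, LinearEquiv.coe_coe, this, Submodule.liftQ_apply]
  exact LinearMap.congr_fun h1 y

end Flatness

/-! ### Transfer of weak dimension between the two sides, and projectivity of homogeneous ideals -/

section WeakDimension

variable {Γ : Type x} [DecidableEq Γ] {S T : Type u} [Ring S] [Ring T] {σ : S ≃+ T}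
variable {op op' : Γ → Γ → Γ} {e e' : Γ} {𝒜 : Γ → AddSubgroup S} {ℬ : Γ → AddSubgroup T}

theorem TorVanishes.extends_ideal (hσ : ∀ a b, σ (a * b) = σ b * σ a) {M : Type u}
    [AddCommGroup M] [Module S M] {J : Submodule T T} (h : TorVanishes σ 0 (T ⧸ J) M) :
    Extends σ J.subtype (LinearMap.id : M →ₗ[S] M) := by
  have := h.extends_ker hσ J.mkQ J.mkQ_surjective
  rwa [Submodule.ker_mkQ] at this

theorem flat_self (hσ : ∀ a b, σ (a * b) = σ b * σ a) : Flat σ S := flat_of_projective hσ S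

/-- A graded module `M` with `Tor_{n + 1}(T / J, M) = 0` for all finitely generated homogeneous
ideals `J` has a flat resolution of length `n`. -/
theorem IsGradedModule.hasFlatResolution (hσ : ∀ a b, σ (a * b) = σ b * σ a)
    (h : IsRingGrading op e 𝒜) (n : ℕ) {M : Type u} [AddCommGroup M] [Module S M]
    {𝓜 : Γ → AddSubgroup M} (hM : IsGradedModule op 𝒜 𝓜)
    (hJ : ∀ (κ : Type u) [Fintype κ] (r : κ → S), (∀ i, ∃ α, r i ∈ 𝒜 α) →
      TorVanishes σ.symm n M (T ⧸ Submodule.span T (Set.range fun i => σ (r i)))) :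
    HasFlatResolution σ M n := by
  induction n generalizing M with
  | zero =>
    refine hasFlatResolution_zero_iff.2 (hM.flat hσ h fun κ _ r hr => ?_)
    have := hJ κ r hr _ (Submodule.mkQ _) (flat_self (symm_mul_rev hσ))
      (Submodule.mkQ_surjective _)
    rw [Submodule.ker_mkQ] at this
    exact extends_symm_iff.1 this
  | succ n ih =>
    obtain ⟨ι, deg, b, hb, hs⟩ := hM.exists_cover
    have hF := flat_finsupp hσ ι
    refine HasResolutionOfLength.succ hF _ hs (ih
      ((isGradedModule_freeGrading h deg).submodule _ (component_mem_ker h hM hb)) ?_)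
    -- With `σ.symm`, `M` occupies the argument in which `TorVanishes` shifts by definition, so the
    -- hypothesis passes directly to the kernel of the cover.
    exact fun κ _ r hr => hJ κ r hr _ _ hF hs

theorem isGradedModule_quotient_span (h : IsRingGrading op e 𝒜) {κ : Type w} {r : κ → S}
    (hr : ∀ i, ∃ α, r i ∈ 𝒜 α) : IsGradedModule op 𝒜 fun δ =>
      (𝒜 δ).map (Submodule.span S (Set.range r)).mkQ.toAddMonoidHom :=
  h.toIsGradedModule.quotient _ fun δ _ hm =>
    h.toIsGradedModule.component_mem_span h.isInternal (by rintro _ ⟨i, rfl⟩; exact hr i) δ hm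

/-- The test modules `T / J` are graded, hence have flat resolutions of length `n`, which kills
`Tor_{n+1}` against them. -/
theorem hasFlatResolution_of_opposite (hσ : ∀ a b, σ (a * b) = σ b * σ a)
    (h : IsRingGrading op e 𝒜) (h' : IsRingGrading op' e' ℬ)
    (hAB : ∀ α, ∀ r ∈ 𝒜 α, σ r ∈ ℬ α) (n : ℕ)
    (hn : ∀ (N : Type u) [AddCommGroup N] [Module T N] (𝓝 : Γ → AddSubgroup N),
      IsGradedModule op' ℬ 𝓝 → HasFlatResolution σ.symm N n)
    {M : Type u} [AddCommGroup M] [Module S M] {𝓜 : Γ → AddSubgroup M}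
    (hM : IsGradedModule op 𝒜 𝓜) : HasFlatResolution σ M n :=
  hM.hasFlatResolution hσ h n fun _ _ _ hr =>
    (hn _ _ (isGradedModule_quotient_span h' fun i => (hr i).imp fun α hα =>
      hAB α _ hα)).torVanishes (symm_mul_rev hσ)

/-- If the finitely generated homogeneous ideals of `T` are projective, then graded `S`-modules
have flat resolutions of length one. -/
theorem hasFlatResolution_one_of_projective (hσ : ∀ a b, σ (a * b) = σ b * σ a)
    (h : IsRingGrading op e 𝒜) (hAB : ∀ α, ∀ r ∈ 𝒜 α, σ r ∈ ℬ α)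
    (hP : ∀ (κ : Type u) [Fintype κ] (r : κ → T), (∀ i, ∃ α, r i ∈ ℬ α) →
      Module.Projective T (Submodule.span T (Set.range r)))
    {M : Type u} [AddCommGroup M] [Module S M] {𝓜 : Γ → AddSubgroup M}
    (hM : IsGradedModule op 𝒜 𝓜) : HasFlatResolution σ M 1 := by
  refine hM.hasFlatResolution hσ h 1 fun κ _ r hr => ?_
  -- `Tor₂(M, T / J) = Tor₁(M, J)`, and `J` is projective.
  rw [← torVanishes_ker_iff (symm_mul_rev hσ) (Submodule.mkQ _) (flat_self (symm_mul_rev hσ))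
    (Submodule.mkQ_surjective _), Submodule.ker_mkQ]
  have := hP κ (fun i => σ (r i)) fun i => (hr i).imp fun α hα => hAB α _ hα
  exact (flat_of_projective (symm_mul_rev hσ) _).torVanishes_zero (symm_mul_rev hσ)

/-- If graded `S`-modules have flat resolutions of length one, then finitely presented homogeneous
ideals of `S` are projective. -/
theorem projective_of_hasFlatResolution_one (hσ : ∀ a b, σ (a * b) = σ b * σ a)
    (h : IsRingGrading op e 𝒜)
    (hn : ∀ (M : Type u) [AddCommGroup M] [Module S M] (𝓜 : Γ → AddSubgroup M),
      IsGradedModule op 𝒜 𝓜 → HasFlatResolution σ M 1)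
    {κ : Type u} [Finite κ] (r : κ → S) (hr : ∀ i, ∃ α, r i ∈ 𝒜 α)
    [Module.FinitePresentation S (Submodule.span S (Set.range r))] :
    Module.Projective S (Submodule.span S (Set.range r)) := by
  have hI := h.toIsGradedModule.submodule (Submodule.span S (Set.range r)) fun δ _ hm =>
    h.toIsGradedModule.component_mem_span h.isInternal (by rintro _ ⟨i, rfl⟩; exact hr i) δ hm
  choose deg hdeg using hr
  refine hI.projective hσ h (fun κ' _ r' hr' => ?_) (ι := κ) (deg := deg)
    (b := fun i => ⟨r i, Submodule.subset_span ⟨i, rfl⟩⟩) hdeg ?_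
  -- The bound is applied to the graded module `S / I`, not to `I` itself: `Tor₂(T / J, S / I) = 0`
  -- shifts to `Tor₁(T / J, I) = 0`, which is injectivity on `J ⊗ I`.
  · have h1 := (hn _ _ (isGradedModule_quotient_span h fun i => ⟨_, hdeg i⟩)).torVanishes hσ
      (N := T ⧸ Submodule.span T (Set.range fun i => σ (r' i)))
    rw [← torVanishes_ker_iff hσ (Submodule.mkQ _) (flat_self hσ) (Submodule.mkQ_surjective _),
      Submodule.ker_mkQ] at h1
    exact h1.extends_ideal hσ
  · rintro ⟨m, hm⟩
    obtain ⟨c, rfl⟩ := (Finsupp.mem_span_range_iff_exists_finsupp).1 hm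
    refine ⟨c, Subtype.ext ?_⟩
    rw [Finsupp.linearCombination_apply, Finsupp.sum, AddSubmonoidClass.coe_finsetSum]
    rfl

end WeakDimension

/-! ### Homogeneous ideals as spans of finite homogeneous families -/

section HomogeneousIdeals

variable {Γ : Type x} {R : Type u} [Ring R]

/-- The grading of the opposite ring with the same components. -/
def opGrading (𝒜 : Γ → AddSubgroup R) (α : Γ) : AddSubgroup Rᵐᵒᵖ :=
  (𝒜 α).comap (opAdd R).symm.toAddMonoidHom

variable {𝒜 : Γ → AddSubgroup R}

/-- A property of submodules holds for the finitely generated homogeneous left ideals if and only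
if it holds for the spans of finite families of homogeneous elements. -/
theorem forall_homogeneousLeftIdeal_iff (P : Submodule R R → Prop) :
    (∀ I, IsHomogeneousLeftIdeal 𝒜 I → I.FG → P I) ↔
      ∀ (κ : Type u) [Finite κ] (r : κ → R), (∀ i, ∃ α, r i ∈ 𝒜 α) →
        P (Submodule.span R (Set.range r)) := by
  constructor
  · exact fun h κ _ r hr => h _ ⟨Set.range r, by rintro _ ⟨i, rfl⟩; exact hr i, rfl⟩
      (Submodule.fg_span (Set.finite_range r))
  · rintro h _ ⟨s, hs, rfl⟩ hI
    -- Finitely many of the given homogeneous generators already suffice.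
    obtain ⟨t, ht, hst⟩ := (Submodule.fg_span_iff_fg_span_finset_subset s).1 hI
    rw [hst]
    have := h t Subtype.val fun i => hs _ (ht i.2)
    rwa [Subtype.range_coe] at this

theorem forall_homogeneousRightIdeal_iff (P : Submodule Rᵐᵒᵖ R → Prop) :
    (∀ I, IsHomogeneousRightIdeal 𝒜 I → I.FG → P I) ↔
      ∀ (κ : Type u) [Finite κ] (r : κ → Rᵐᵒᵖ), (∀ i, ∃ α, r i ∈ opGrading 𝒜 α) →
        P (Submodule.span Rᵐᵒᵖ (Set.range fun i => (r i).unop)) := by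
  constructor
  · exact fun h κ _ r hr => h _ ⟨_, by rintro _ ⟨i, rfl⟩; exact hr i, rfl⟩
      (Submodule.fg_span (Set.finite_range _))
  · rintro h _ ⟨s, hs, rfl⟩ hI
    obtain ⟨t, ht, hst⟩ := (Submodule.fg_span_iff_fg_span_finset_subset s).1 hI
    rw [hst]
    have := h t (fun i => MulOpposite.op i) fun i => hs _ (ht i.2)
    change P (Submodule.span Rᵐᵒᵖ (Set.range ((↑) : t → R))) at this
    rwa [Subtype.range_coe] at this

/-- A right ideal spanned by a family, as a left ideal of the opposite ring. -/
noncomputable def spanUnopEquiv {κ : Type w} (r : κ → Rᵐᵒᵖ) :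
    Submodule.span Rᵐᵒᵖ (Set.range fun i => (r i).unop) ≃ₗ[Rᵐᵒᵖ]
      Submodule.span Rᵐᵒᵖ (Set.range r) :=
  (MulOpposite.opLinearEquiv Rᵐᵒᵖ).ofSubmodules _ _ (by
    rw [Submodule.map_span, ← Set.range_comp]
    rfl)

end HomogeneousIdeals

/-! ### Specialisation to a graded ring and its opposite -/

section Opposite

variable {Γ : Type x} [AddCancelMonoid Γ] [DecidableEq Γ] {R : Type u} [Ring R]

theorem isRingGrading_of_gradedRing (𝒜 : Γ → AddSubgroup R) [GradedRing 𝒜] :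
    IsRingGrading (fun a b : Γ => a + b) 0 𝒜 where
  assoc := add_assoc
  id_left := zero_add
  left_injective := add_right_injective
  right_injective := add_left_injective
  isInternal := DirectSum.Decomposition.isInternal 𝒜
  smul_mem _ _ _ _ hr hm := SetLike.mul_mem_graded hr hm
  one_mem := SetLike.one_mem_graded 𝒜

/-- Degrees multiply in reverse order in `Rᵐᵒᵖ`, so the two cancellation laws trade places. This is
why the operation on degrees is a parameter throughout. -/
theorem isRingGrading_opGrading (𝒜 : Γ → AddSubgroup R) [GradedRing 𝒜] :
    IsRingGrading (fun a b : Γ => b + a) 0 (opGrading 𝒜) where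
  assoc a b c := (add_assoc c b a).symm
  id_left := add_zero
  left_injective := add_left_injective
  right_injective := add_right_injective
  isInternal := by
    have h := DirectSum.Decomposition.isInternal 𝒜
    refine isInternal_of_components (fun δ => (opAdd R).toAddMonoidHom.comp
      ((component h δ).comp (opAdd R).symm.toAddMonoidHom))
      (fun δ m hm => congrArg MulOpposite.op (component_of_mem h hm))
      (fun δ δ' hne m hm => congrArg MulOpposite.op (component_of_mem_ne h hm hne)) fun m => ?_
    obtain ⟨s, hs⟩ := exists_sum_component h m.unop
    have hm : m = ∑ δ ∈ s, MulOpposite.op (component h δ m.unop) := by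
      conv_lhs => rw [← MulOpposite.op_unop m, ← hs]
      exact map_sum (opAdd R) _ _
    rw [hm]
    exact sum_mem fun δ _ => AddSubgroup.mem_iSup_of_mem δ (component_mem h δ m.unop)
  smul_mem _ _ _ _ hr hm := SetLike.mul_mem_graded (A := 𝒜) hm hr
  one_mem := SetLike.one_mem_graded 𝒜

variable {𝒜 : Γ → AddSubgroup R}

theorem isGradedLeftModule_iff {M : Type v} [AddCommGroup M] [Module R M]
    {𝓜 : Γ → AddSubgroup M} :
    IsGradedLeftModule 𝒜 𝓜 ↔ IsGradedModule (fun a b => a + b) 𝒜 𝓜 :=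
  ⟨fun h => ⟨h.1, h.2⟩, fun h => ⟨h.1, h.2⟩⟩

theorem isGradedRightModule_iff {N : Type v} [AddCommGroup N] [Module Rᵐᵒᵖ N]
    {𝓝 : Γ → AddSubgroup N} :
    IsGradedRightModule 𝒜 𝓝 ↔ IsGradedModule (fun a b => b + a) (opGrading 𝒜) 𝓝 :=
  ⟨fun h => ⟨h.1, fun α β r n hr hn => h.2 α β r.unop n hr hn⟩,
    fun h => ⟨h.1, fun α β r n hr hn => h.2 α β (MulOpposite.op r) n hr hn⟩⟩

/-- If `Q n` fails, upward closure puts every admissible `m` at `n + 1` or beyond; the empty infimum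
is `⊤`. -/
theorem iInf_natCast_le_iff {Q : ℕ → Prop} (hQ : ∀ m n, Q m → m ≤ n → Q n) (n : ℕ) :
    (⨅ (m : ℕ) (_ : Q m), (m : ℕ∞)) ≤ n ↔ Q n := by
  refine ⟨fun h => ?_, fun h => iInf₂_le n h⟩
  by_contra hn
  have h1 : ((n + 1 : ℕ) : ℕ∞) ≤ ⨅ (m : ℕ) (_ : Q m), (m : ℕ∞) :=
    le_iInf₂ fun m hm => Nat.cast_le.2 (not_le.1 fun hmn => hn (hQ m n hm hmn))
  exact absurd (Nat.cast_le.1 (h1.trans h)) (Nat.not_succ_le_self n)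

theorem flatDimLeft_le_iff {M : Type u} [AddCommGroup M] [Module R M] {n : ℕ} :
    flatDimLeft R M ≤ n ↔ HasFlatResolution (opAdd R) M n := by
  unfold flatDimLeft
  simp only [isFlatLeft_iff]
  exact iInf_natCast_le_iff (fun _ _ h => h.mono) n

theorem flatDimRight_le_iff {N : Type u} [AddCommGroup N] [Module Rᵐᵒᵖ N] {n : ℕ} :
    flatDimRight R N ≤ n ↔ HasFlatResolution (opAdd R).symm N n := by
  unfold flatDimRight
  simp only [isFlatRight_iff]
  exact iInf_natCast_le_iff (fun _ _ h => h.mono) n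

theorem grLeftWeakDim_le_iff {n : ℕ} :
    grLeftWeakDim 𝒜 ≤ n ↔ ∀ (M : Type u) [AddCommGroup M] [Module R M] (𝓜 : Γ → AddSubgroup M),
      IsGradedModule (fun a b => a + b) 𝒜 𝓜 → HasFlatResolution (opAdd R) M n := by
  simp only [grLeftWeakDim, iSup_le_iff, flatDimLeft_le_iff, isGradedLeftModule_iff]

theorem grRightWeakDim_le_iff {n : ℕ} :
    grRightWeakDim 𝒜 ≤ n ↔ ∀ (N : Type u) [AddCommGroup N] [Module Rᵐᵒᵖ N]
      (𝓝 : Γ → AddSubgroup N), IsGradedModule (fun a b => b + a) (opGrading 𝒜) 𝓝 →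
        HasFlatResolution (opAdd R).symm N n := by
  simp only [grRightWeakDim, iSup_le_iff, flatDimRight_le_iff, isGradedRightModule_iff]

theorem grLeftWeakDim_eq_grRightWeakDim (𝒜 : Γ → AddSubgroup R) [GradedRing 𝒜] :
    grLeftWeakDim 𝒜 = grRightWeakDim 𝒜 := by
  have hl := isRingGrading_of_gradedRing 𝒜
  have hr := isRingGrading_opGrading 𝒜
  -- Comparing natural upper bounds suffices, which also covers infinite dimension.
  have key : ∀ a b : ℕ∞, (∀ n : ℕ, b ≤ n → a ≤ n) → a ≤ b := fun a b h => by
    induction b using ENat.recTopCoe with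
    | top => exact le_top
    | coe n => exact h n le_rfl
  refine le_antisymm (key _ _ fun n hn => ?_) (key _ _ fun n hn => ?_)
  · rw [grRightWeakDim_le_iff] at hn
    rw [grLeftWeakDim_le_iff]
    exact fun M _ _ 𝓜 hM =>
      hasFlatResolution_of_opposite opAdd_mul hl hr (fun _ _ h => h) n hn hM
  · rw [grLeftWeakDim_le_iff] at hn
    rw [grRightWeakDim_le_iff]
    exact fun N _ _ 𝓝 hN =>
      hasFlatResolution_of_opposite (symm_mul_rev opAdd_mul) hr hl (fun _ _ h => h) n hn hN

theorem isGradedLeftSemihereditary_iff (𝒜 : Γ → AddSubgroup R) [GradedRing 𝒜] :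
    IsGradedLeftSemihereditary 𝒜 ↔ IsGradedLeftCoherent 𝒜 ∧ grWeakDim 𝒜 ≤ 1 := by
  have hl := isRingGrading_of_gradedRing 𝒜
  have hr := isRingGrading_opGrading 𝒜
  constructor
  · refine fun h => ⟨fun I hI hfg => ?_, ?_⟩
    · have := h I hI hfg
      have := Module.Finite.iff_fg.2 hfg
      exact Module.finitePresentation_of_projective R I
    -- Projective left ideals bound the flat dimension of right modules, so the equality of the two
    -- dimensions is needed here.
    · rw [grWeakDim, grLeftWeakDim_eq_grRightWeakDim, ← Nat.cast_one, grRightWeakDim_le_iff]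
      intro N _ _ 𝓝 hN
      exact hasFlatResolution_one_of_projective (symm_mul_rev opAdd_mul) hr (ℬ := 𝒜)
        (fun _ _ h => h)
        (fun κ _ r => (forall_homogeneousLeftIdeal_iff fun I => Module.Projective R I).1 h κ r) hN
  · rintro ⟨hc, hw⟩
    rw [grWeakDim, ← Nat.cast_one, grLeftWeakDim_le_iff] at hw
    refine (forall_homogeneousLeftIdeal_iff fun I => Module.Projective R I).2 fun κ _ r hκ => ?_
    have := (forall_homogeneousLeftIdeal_iff fun I => Module.FinitePresentation R I).1 hc κ r hκ
    exact projective_of_hasFlatResolution_one opAdd_mul hl hw r hκ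

theorem isGradedRightSemihereditary_iff (𝒜 : Γ → AddSubgroup R) [GradedRing 𝒜] :
    IsGradedRightSemihereditary 𝒜 ↔ IsGradedRightCoherent 𝒜 ∧ grWeakDim 𝒜 ≤ 1 := by
  have hl := isRingGrading_of_gradedRing 𝒜
  have hr := isRingGrading_opGrading 𝒜
  constructor
  · refine fun h => ⟨fun I hI hfg => ?_, ?_⟩
    · have := h I hI hfg
      have := Module.Finite.iff_fg.2 hfg
      exact Module.finitePresentation_of_projective Rᵐᵒᵖ I
    · rw [grWeakDim, ← Nat.cast_one, grLeftWeakDim_le_iff]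
      intro M _ _ 𝓜 hM
      refine hasFlatResolution_one_of_projective opAdd_mul hl (ℬ := opGrading 𝒜)
        (fun _ _ h => h) (fun κ _ r hκ => ?_) hM
      have := (forall_homogeneousRightIdeal_iff fun I => Module.Projective Rᵐᵒᵖ I).1 h κ r hκ
      exact Module.Projective.of_equiv (spanUnopEquiv r)
  · rintro ⟨hc, hw⟩
    rw [grWeakDim, grLeftWeakDim_eq_grRightWeakDim, ← Nat.cast_one, grRightWeakDim_le_iff] at hw
    refine (forall_homogeneousRightIdeal_iff fun I => Module.Projective Rᵐᵒᵖ I).2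
      fun κ _ r hκ => ?_
    have := (forall_homogeneousRightIdeal_iff fun I => Module.FinitePresentation Rᵐᵒᵖ I).1 hc κ r hκ
    have := Module.FinitePresentation.of_equiv (spanUnopEquiv r)
    have := projective_of_hasFlatResolution_one (symm_mul_rev opAdd_mul) hr hw r hκ
    exact Module.Projective.of_equiv (spanUnopEquiv r).symm

end Opposite

end GrSemihereditary

theorem corollary2p11 {Γ : Type*} [AddCancelMonoid Γ] [DecidableEq Γ] {R : Type*} [Ring R]
    (𝒜 : Γ → AddSubgroup R) [GradedRing 𝒜] :
    GrSemihereditary.grLeftWeakDim 𝒜 = GrSemihereditary.grRightWeakDim 𝒜 ∧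
    (GrSemihereditary.IsGradedLeftSemihereditary 𝒜 ↔
      GrSemihereditary.IsGradedLeftCoherent 𝒜 ∧ GrSemihereditary.grWeakDim 𝒜 ≤ 1) ∧
    (GrSemihereditary.IsGradedRightSemihereditary 𝒜 ↔
      GrSemihereditary.IsGradedRightCoherent 𝒜 ∧ GrSemihereditary.grWeakDim 𝒜 ≤ 1) :=
  ⟨GrSemihereditary.grLeftWeakDim_eq_grRightWeakDim 𝒜,
    GrSemihereditary.isGradedLeftSemihereditary_iff 𝒜,
    GrSemihereditary.isGradedRightSemihereditary_iff 𝒜⟩
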